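/- Let $p$ and $d$ be distinct primes, both larger than $3$, let $q=p^h$ with $h\ge 1$, and fix $\omega\in\mathbb F_{q^2}$ with $\omega^{q-1}=-1$. Let $\mathcal H_q$ be the Hermitian curve $y^q-y+\omega x^{q+1}=0$, let $Y_\infty=(0:1:0)$ be its point at infinity, and let $\mathrm{PGU}(3,q)\le \mathrm{PGL}(3,q^2)$ be the projective unitary group of the associated form $Y^qZ-YZ^q+\omega X^{q+1}$, i.e. the image in $\mathrm{PGL}(3,q^2)$ of the group of linear isometries of this form. For $a,b\in\mathbb F_{q^2}$ and $\lambda\in\mathbb F_{q^2}^*$ let $\varphi_{a,b,\lambda}\in\mathrm{PGL}(3,q^2)$ be the projectivity given in affine coordinates by $$(x,y)\mapsto(\lambda x+a,\ a^q\lambda\omega x+\lambda^{q+1}y+b).$$ Up to conjugacy in $\mathrm{PGU}(3,q)$ there are at most three subgroups of order $dp$ in $\mathrm{PGU}(3,q)$, and representatives can be chosen inside the stabiliser of $Y_\infty$ in $\mathrm{PGU}(3,q)$. More precisely, if $\mathrm{PGU}(3,q)$ has a subgroup $G$ of order $dp$, then $\mathbb F_{q^2}^*$ has elements of order $d$, and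 for every $\lambda\in\mathbb F_{q^2}^*$ of order $d$ the group $G$ is conjugate in $\mathrm{PGU}(3,q)$ to one of the following: (I) $\Sigma_p\times\Sigma_d$ with $\Sigma_p=\langle\varphi_{0,1,1}\rangle$, $\Sigma_d=\langle\varphi_{0,0,\lambda}\rangle$, and $d\mid q+1$; (II) $\Sigma_p\rtimes\Sigma_d$ with $\Sigma_p=\langle\varphi_{0,1,1}\rangle$, $\Sigma_d=\langle\varphi_{0,0,\lambda}\rangle$, and $d\mid p-1$ (so $d<p$); (III) $\Sigma_p\rtimes\Sigma_d$ with $\Sigma_p=\langle\varphi_{1,\omega/2,1}\rangle$, $\Sigma_d=\langle\varphi_{0,0,\lambda}\rangle$, and $d\mid p-1$ (so $d<p$). Conversely, for every $\lambda\in\mathbb F_{q^2}^*$ of order $d$, under the stated divisibility condition each of the groups (I), (II), (III) is a subgroup of order $dp$ of the stabiliser of $Y_\infty$ in $\mathrm{PGU}(3,q)$, with $|\Sigma_p|=p$ and $|\Sigma_d|=d$; it is the internal direct product (I) or semidirect product with normal factor $\Sigma_p$ (II, III) of $\Sigma_p$ and $\Sigma_d$; the group (I) is cyclic, and the groups (II)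 and (III) are not abelian. -/

import Mathlib

open scoped MatrixGroups LinearAlgebra.Projectivization

namespace Hermitian

variable {K : Type*} [Field K]

/-- The matrix of the form `ω X^{q+1} + Y^q Z - Z^q Y`, in the coordinates `(X, Y, Z)`, whose
isotropic points are the points of the Hermitian curve `y^q - y + ω x^{q+1} = 0`
(`x = X / Z`, `y = Y / Z`).  When `ω^{q-1} = -1`, its multiple by `ω` is a nondegenerate
Hermitian matrix, with the same isometries. -/
def formMatrix (ω : K) : Matrix (Fin 3) (Fin 3) K :=
  !![ω, 0, 0;
     0, 0, 1;
     0, -1, 0]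

/-- The group of isometries of the `σ`-sesquilinear form with matrix `J`: all invertible `A` with
`(A^σ)ᵀ J A = J`. -/
def isometryGroup (σ : K →+* K) (J : Matrix (Fin 3) (Fin 3) K) : Subgroup (GL (Fin 3) K) where
  carrier := {A | ((A : Matrix (Fin 3) (Fin 3) K).map σ).transpose * J * A = J}
  one_mem' := by simp
  mul_mem' := by
    intro A B hA hB
    simp only [Set.mem_ofPred_eq] at hA hB ⊢
    rw [Units.val_mul, Matrix.map_mul, Matrix.transpose_mul]
    calc _ = ((B : Matrix (Fin 3) (Fin 3) K).map σ).transpose *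
          (((A : Matrix (Fin 3) (Fin 3) K).map σ).transpose * J * A) * B := by
            simp only [mul_assoc]
      _ = J := by rw [hA, hB]
  inv_mem' := by
    intro A hA
    simp only [Set.mem_ofPred_eq] at hA ⊢
    have h : (((A⁻¹ : GL (Fin 3) K) : Matrix (Fin 3) (Fin 3) K).map σ).transpose *
        ((A : Matrix (Fin 3) (Fin 3) K).map σ).transpose = 1 := by
      rw [← Matrix.transpose_mul, ← Matrix.map_mul, Units.mul_inv]
      simp
    calc _ = (((A⁻¹ : GL (Fin 3) K) : Matrix (Fin 3) (Fin 3) K).map σ).transpose *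
          (((A : Matrix (Fin 3) (Fin 3) K).map σ).transpose * J * A) *
          ((A⁻¹ : GL (Fin 3) K) : Matrix (Fin 3) (Fin 3) K) := by rw [hA]
      _ = ((((A⁻¹ : GL (Fin 3) K) : Matrix (Fin 3) (Fin 3) K).map σ).transpose *
          ((A : Matrix (Fin 3) (Fin 3) K).map σ).transpose) * J *
          ((A : Matrix (Fin 3) (Fin 3) K) *
            ((A⁻¹ : GL (Fin 3) K) : Matrix (Fin 3) (Fin 3) K)) := by
            simp only [mul_assoc]
      _ = J := by rw [h, Units.mul_inv, one_mul, mul_one]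

/-- The unitary group `GU(3, q)`, `q = p^h`, of the Hermitian curve
`y^q - y + ω x^{q+1} = 0` over a field `K` with `q^2` elements; the involution of `K` is
`x ↦ x^q`. -/
def GU (p h : ℕ) [ExpChar K p] (ω : K) : Subgroup (GL (Fin 3) K) :=
  isometryGroup (iterateFrobenius K p h) (formMatrix ω)

/-- The projective unitary group `PGU(3, q)`: the image of `GU(3, q)` in `PGL(3, q^2)`. -/
def PGU (p h : ℕ) [ExpChar K p] (ω : K) : Subgroup PGL(3, K) :=
  (GU p h ω).map Matrix.ProjGenLinGroup.mk

/-- The point at infinity `(0 : 1 : 0)` of the Hermitian curve. -/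
def Yinf (K : Type*) [Field K] : ℙ K (Fin 3 → K) :=
  Projectivization.mk K ![0, 1, 0] (fun h => one_ne_zero (congrFun h 1))

/-- The stabiliser of `Y_∞` in `PGU(3, q)`. -/
def stabYinf (p h : ℕ) [ExpChar K p] (ω : K) : Subgroup PGL(3, K) :=
  PGU p h ω ⊓ MulAction.stabilizer PGL(3, K) (Yinf K)

/-- The projectivity `φ_{a,b,l}`, in affine coordinates
`(x, y) ↦ (l x + a, a^q l ω x + l^{q+1} y + b)`. -/
def phi (q : ℕ) (ω a b : K) (l : Kˣ) : PGL(3, K) :=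
  Matrix.ProjGenLinGroup.mk <| Matrix.GeneralLinearGroup.mkOfDetNeZero
    !![(l : K), 0, a;
       a ^ q * l * ω, (l : K) ^ (q + 1), b;
       0, 0, 1]
    (by simp [Matrix.det_fin_three])

/-- The group `⟨φ_{0,1,1}⟩`. -/
def sigmaCentral (q : ℕ) (ω : K) : Subgroup PGL(3, K) :=
  Subgroup.zpowers (phi q ω 0 1 1)

/-- The group `⟨φ_{1,ω/2,1}⟩`. -/
def sigmaNoncentral (q : ℕ) (ω : K) : Subgroup PGL(3, K) :=
  Subgroup.zpowers (phi q ω 1 (ω / 2) 1)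

/-- The group `⟨φ_{0,0,l}⟩`. -/
def sigmaDiag (q : ℕ) (ω : K) (l : Kˣ) : Subgroup PGL(3, K) :=
  Subgroup.zpowers (phi q ω 0 0 l)

/-- The subgroup generated by `⟨φ_{0,1,1}⟩` and `⟨φ_{0,0,l}⟩`. -/
def centralGroup (q : ℕ) (ω : K) (l : Kˣ) : Subgroup PGL(3, K) :=
  sigmaCentral q ω ⊔ sigmaDiag q ω l

/-- The subgroup generated by `⟨φ_{1,ω/2,1}⟩` and `⟨φ_{0,0,l}⟩`. -/
def noncentralGroup (q : ℕ) (ω : K) (l : Kˣ) : Subgroup PGL(3, K) :=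
  sigmaNoncentral q ω ⊔ sigmaDiag q ω l

end Hermitian

/-- `H` and `H'` are conjugate by an element of the subgroup `P`. -/
def ConjugateIn {G : Type*} [Group G] (P H H' : Subgroup G) : Prop :=
  ∃ g ∈ P, H.map (MulAut.conj g).toMonoidHom = H'

/-- `H` is the internal semidirect product `N ⋊ C` of its subgroups `N` (normal in `H`)
and `C`. -/
def IsInternalSemidirect {G : Type*} [Group G] (H N C : Subgroup G) : Prop :=
  N ≤ H ∧ C ≤ H ∧ (N.subgroupOf H).Normal ∧ (N.subgroupOf H).IsComplement' (C.subgroupOf H)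

/-- `H` is the internal direct product `N × C` of its subgroups `N` and `C`. -/
def IsInternalDirect {G : Type*} [Group G] (H N C : Subgroup G) : Prop :=
  IsInternalSemidirect H N C ∧ (C.subgroupOf H).Normal

/-! A group of order `d * p` is generated by `x` of order `p` and `y` of order `d`, one of which
normalises the cyclic group of the other. If `x` normalises `⟨y⟩`, the two commute
(`commute_of_conj_eq_pow`): a lift of `y` is diagonalisable over the algebraic closure with at most
three eigenvalues, and a conjugation of order dividing `p > 3` cannot permute them nontrivially. So
in every case `y` normalises `⟨x⟩`.

A lift of `x` is unipotent, `1 + N`, and the image of the last nonzero power of `N` is an isotropic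
line invariant under `x` and `y` (`exists_isotropic_fixed`). Isotropic points form one orbit
(`exists_smul_eq_Yinf`), so the group moves into the stabiliser of `Y_∞`, where every element is
some `φ_{a,b,l}`. There `y` is made diagonal (`exists_conj_eq_phi_diag`) and `x` becomes
`φ_{a,b,1}`.

The relation `y x y⁻¹ = x ^ k` now reads `l a = k a` and `l^(q+1) b = k b + (k choose 2) ω a^(q+1)`.
If `a = 0`, then `l^(q+1)` lies in the prime field, so `d ∣ (q+1)(p-1)`. If `a ≠ 0`, then `l` itself
lies there, so `d ∣ p - 1`, and `b = ω a^(q+1) / 2` is forced. A diagonal conjugation normalises `b`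
or `a` to `1` (`conjugateIn_representative`). -/

namespace Hermitian

variable {K : Type*} [Field K]

/-! ### Composition, powers and conjugation of the maps `φ_{a,b,l}`. -/

/-- The matrix representing `φ_{a,b,l}` whose last row is `(0, 0, 1)`. -/
def phiGL (q : ℕ) (ω a b : K) (l : Kˣ) : GL (Fin 3) K :=
  Matrix.GeneralLinearGroup.mkOfDetNeZero
    !![(l : K), 0, a;
       a ^ q * l * ω, (l : K) ^ (q + 1), b;
       0, 0, 1]
    (by simp [Matrix.det_fin_three])

lemma coe_phiGL (q : ℕ) (ω a b : K) (l : Kˣ) :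
    (phiGL q ω a b l : Matrix (Fin 3) (Fin 3) K) =
      !![(l : K), 0, a; a ^ q * l * ω, (l : K) ^ (q + 1), b; 0, 0, 1] := rfl

lemma mk_phiGL (q : ℕ) (ω a b : K) (l : Kˣ) :
    Matrix.ProjGenLinGroup.mk (phiGL q ω a b l) = phi q ω a b l := rfl

lemma phi_injective {q : ℕ} {ω a b a' b' : K} {l l' : Kˣ}
    (e : phi q ω a b l = phi q ω a' b' l') : a = a' ∧ b = b' ∧ l = l' := by
  rw [← mk_phiGL, ← mk_phiGL, Matrix.ProjGenLinGroup.mk_eq_mk_iff] at e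
  obtain ⟨u, hu⟩ := e
  have hM := congrArg (fun g : GL (Fin 3) K => (g : Matrix (Fin 3) (Fin 3) K)) hu
  simp only [Units.val_mul, coe_phiGL, Matrix.GeneralLinearGroup.coe_scalar] at hM
  have h22 := congrFun (congrFun hM 2) 2
  have h02 := congrFun (congrFun hM 0) 2
  have h12 := congrFun (congrFun hM 1) 2
  have h00 := congrFun (congrFun hM 0) 0
  simp [Matrix.mul_apply, Fin.sum_univ_three] at h22 h02 h12 h00
  -- Both lower right entries are `1`, so the scalar relating the two matrices is `1`.
  subst h22
  refine ⟨by simpa using h02, by simpa using h12, Units.ext (by simpa using h00)⟩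

section Frobenius

variable (p h : ℕ) [Fact p.Prime] (ω : K)

lemma phi_one : phi (p ^ h) ω 0 0 1 = 1 := by
  have hp : p ≠ 0 := (Fact.out : p.Prime).ne_zero
  rw [← mk_phiGL]
  suffices e : phiGL (p ^ h) ω 0 0 1 = 1 by rw [e, map_one]
  apply Units.ext
  rw [coe_phiGL]
  ext i j
  fin_cases i <;> fin_cases j <;> simp [hp]

lemma phi_eq_one_iff {a b : K} {l : Kˣ} :
    phi (p ^ h) ω a b l = 1 ↔ a = 0 ∧ b = 0 ∧ l = 1 := by
  constructor
  · intro e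
    rw [← phi_one p h ω] at e
    exact phi_injective e
  · rintro ⟨rfl, rfl, rfl⟩
    exact phi_one p h ω

variable [CharP K p]

lemma phi_mul (a b a' b' : K) (l l' : Kˣ) :
    phi (p ^ h) ω a b l * phi (p ^ h) ω a' b' l' =
      phi (p ^ h) ω (a + l * a') (b + a ^ (p ^ h) * l * ω * a' + l ^ (p ^ h + 1) * b')
        (l * l') := by
  simp only [← mk_phiGL, ← map_mul]
  congr 1
  apply Units.ext
  rw [Units.val_mul, coe_phiGL, coe_phiGL, coe_phiGL]
  ext i j
  fin_cases i <;> fin_cases j <;>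
    simp [Matrix.mul_apply, Fin.sum_univ_three, add_pow_char_pow, mul_pow] <;> ring

/-- Composing with a translation whose first coordinate is `i * a` adds the cross term `i * ω *
a^(q+1)`; summing over `i < k` gives the binomial coefficient. -/
lemma phi_translation_pow (a b : K) (k : ℕ) :
    phi (p ^ h) ω a b 1 ^ k =
      phi (p ^ h) ω (k * a) (k * b + (k.choose 2 : K) * (ω * a ^ (p ^ h + 1))) 1 := by
  induction k with
  | zero => simp [phi_one]
  | succ k ih =>
    rw [pow_succ', ih, phi_mul]
    congr 1
    · push_cast; simp; ring
    · rw [Nat.choose_succ_succ' k 1]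
      push_cast
      simp
      ring
    · simp

lemma phi_diag_pow (l : Kˣ) (k : ℕ) :
    phi (p ^ h) ω 0 0 l ^ k = phi (p ^ h) ω 0 0 (l ^ k) := by
  induction k with
  | zero => simp [phi_one]
  | succ k ih =>
    have hp : p ≠ 0 := (Fact.out : p.Prime).ne_zero
    rw [pow_succ, ih, phi_mul, pow_succ l]
    simp [hp]

lemma exists_phi_pow (a b : K) (l : Kˣ) (k : ℕ) :
    ∃ a' b', phi (p ^ h) ω a b l ^ k = phi (p ^ h) ω a' b' (l ^ k) := by
  induction k with
  | zero => exact ⟨0, 0, by simp [phi_one]⟩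
  | succ k ih =>
    obtain ⟨a', b', e⟩ := ih
    rw [pow_succ, e, phi_mul, pow_succ l]
    exact ⟨_, _, rfl⟩

lemma phi_vertical_pow (b : K) (l : Kˣ) (hl : (l : K) ^ (p ^ h + 1) = 1) (k : ℕ) :
    phi (p ^ h) ω 0 b l ^ k = phi (p ^ h) ω 0 (k * b) (l ^ k) := by
  have hp : p ≠ 0 := (Fact.out : p.Prime).ne_zero
  induction k with
  | zero => simp [phi_one]
  | succ k ih =>
    rw [pow_succ', ih, phi_mul, hl, pow_succ' l]
    congr 1 <;> simp [hp]; ring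

lemma phi_diag_conj (a b : K) (m l : Kˣ) :
    phi (p ^ h) ω 0 0 m * phi (p ^ h) ω a b l * (phi (p ^ h) ω 0 0 m)⁻¹ =
      phi (p ^ h) ω (m * a) (m ^ (p ^ h + 1) * b) l := by
  have hp : p ≠ 0 := (Fact.out : p.Prime).ne_zero
  rw [mul_inv_eq_iff_eq_mul, phi_mul, phi_mul]
  congr 1
  · simp
  · simp [hp]
  · rw [mul_comm]

lemma phi_vertical_conj (t b : K) (l : Kˣ) :
    phi (p ^ h) ω 0 t 1 * phi (p ^ h) ω 0 b l * (phi (p ^ h) ω 0 t 1)⁻¹ =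
      phi (p ^ h) ω 0 (b + t - l ^ (p ^ h + 1) * t) l := by
  have hp : p ≠ 0 := (Fact.out : p.Prime).ne_zero
  rw [mul_inv_eq_iff_eq_mul, phi_mul, phi_mul]
  congr 1
  · simp
  · simp [hp]; ring
  · rw [mul_comm]

/-- Only the first coordinate has to be known explicitly: the second is controlled afterwards by the
curve equation (`curve_of_phi_mem_stabYinf`). -/
lemma exists_phi_conj (s t a b : K) (l : Kˣ) :
    ∃ b', phi (p ^ h) ω s t 1 * phi (p ^ h) ω a b l * (phi (p ^ h) ω s t 1)⁻¹ =
      phi (p ^ h) ω (a + s - l * s) b' l := by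
  refine ⟨t + s ^ (p ^ h) * ω * a + b - (a + s - l * s) ^ (p ^ h) * l * ω * s
    - l ^ (p ^ h + 1) * t, ?_⟩
  rw [mul_inv_eq_iff_eq_mul, phi_mul, phi_mul]
  congr 1
  · simp; ring
  · simp; ring
  · rw [mul_comm]

end Frobenius

/-! ### The Hermitian form, the stabiliser of `Y_∞`, and the orbit of isotropic points. -/

section Unitary

variable {p h : ℕ} [Fact p.Prime] {ω : K}

lemma pow_eq_neg (hω : ω ^ (p ^ h - 1) = -1) : ω ^ (p ^ h) = -ω := by
  have : p ^ h = p ^ h - 1 + 1 := (Nat.sub_add_cancel (Nat.one_le_pow _ _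
    (Fact.out : p.Prime).pos)).symm
  rw [this, pow_succ, hω, neg_one_mul]

variable [CharP K p]

/-- The sesquilinear form with matrix `formMatrix ω`. -/
def form (q : ℕ) (ω : K) (u v : Fin 3 → K) : K :=
  ω * u 0 ^ q * v 0 + u 1 ^ q * v 2 - u 2 ^ q * v 1

lemma mem_GU_iff {A : GL (Fin 3) K} :
    A ∈ GU p h ω ↔ ((A : Matrix (Fin 3) (Fin 3) K).map
      (iterateFrobenius K p h)).transpose * formMatrix ω * A = formMatrix ω := Iff.rfl

lemma form_eq_dotProduct (u v : Fin 3 → K) :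
    form (p ^ h) ω u v = (iterateFrobenius K p h ∘ u) ⬝ᵥ (formMatrix ω).mulVec v := by
  simp [form, formMatrix, dotProduct, Matrix.mulVec, Fin.sum_univ_three, iterateFrobenius_def]
  ring

lemma form_mulVec {A : GL (Fin 3) K} (hA : A ∈ GU p h ω) (u v : Fin 3 → K) :
    form (p ^ h) ω (A.1.mulVec u) (A.1.mulVec v) = form (p ^ h) ω u v := by
  have e : iterateFrobenius K p h ∘ A.1.mulVec u =
      (A.1.map (iterateFrobenius K p h)).mulVec (iterateFrobenius K p h ∘ u) :=
    funext fun i => RingHom.map_mulVec _ _ _ i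
  rw [form_eq_dotProduct, form_eq_dotProduct, e, Matrix.mulVec_mulVec,
    ← Matrix.vecMul_transpose, ← Matrix.dotProduct_mulVec, Matrix.mulVec_mulVec, ← mul_assoc,
    mem_GU_iff.mp hA]

lemma mem_GU_iff_form {A : GL (Fin 3) K} :
    A ∈ GU p h ω ↔
      ∀ i j, form (p ^ h) ω (fun k => A.1 k i) (fun k => A.1 k j) = formMatrix ω i j := by
  rw [mem_GU_iff, ← Matrix.ext_iff]
  refine forall₂_congr fun i j => ?_
  rw [form_eq_dotProduct, mul_assoc, Matrix.mul_apply']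
  rfl

lemma pow_eq_one_of_scalar_mem_GU {c : Kˣ}
    (hc : Matrix.GeneralLinearGroup.scalar (Fin 3) c ∈ GU p h ω) :
    (c : K) ^ (p ^ h + 1) = 1 := by
  have hp : p ≠ 0 := (Fact.out : p.Prime).ne_zero
  have := mem_GU_iff_form.mp hc 1 2
  simpa [form, formMatrix, hp, pow_succ] using this

lemma phi_mem_PGU (hF : ∀ x : K, (x ^ p ^ h) ^ p ^ h = x)
    (hω : ω ^ (p ^ h) = -ω) {a b : K} (l : Kˣ)
    (hb : b ^ (p ^ h) - b + ω * a ^ (p ^ h + 1) = 0) : phi (p ^ h) ω a b l ∈ PGU p h ω := by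
  have hp : p ≠ 0 := (Fact.out : p.Prime).ne_zero
  have hl : (l : K) ≠ 0 := l.ne_zero
  -- `phiGL` multiplies the form by `l^(q+1)`; dividing the matrix by `l` turns it into an isometry.
  refine ⟨phiGL (p ^ h) ω a b l * Matrix.GeneralLinearGroup.scalar (Fin 3) l⁻¹, ?_, ?_⟩
  · have hM : (phiGL (p ^ h) ω a b l * Matrix.GeneralLinearGroup.scalar (Fin 3) l⁻¹).1 =
        !![1, 0, a / l; a ^ p ^ h * ω, (l : K) ^ p ^ h, b / l; 0, 0, 1 / l] := by
      rw [Units.val_mul, coe_phiGL, Matrix.GeneralLinearGroup.coe_scalar]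
      ext i j
      fin_cases i <;> fin_cases j <;>
        simp [Matrix.mul_apply, Fin.sum_univ_three] <;> field_simp <;> ring
    rw [SetLike.mem_coe, mem_GU_iff_form, hM]
    have hl' : (l : K) ^ p ^ h ≠ 0 := pow_ne_zero _ hl
    intro i j
    fin_cases i <;> fin_cases j <;> simp [form, formMatrix, hp, div_pow, mul_pow, hω, hF] <;>
      field_simp <;> first | linear_combination hb | ring
  · rw [map_mul, Matrix.ProjGenLinGroup.mk_scalar, mul_one, mk_phiGL]

lemma phi_mem_stabYinf (hF : ∀ x : K, (x ^ p ^ h) ^ p ^ h = x)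
    (hω : ω ^ (p ^ h) = -ω) {a b : K} (l : Kˣ)
    (hb : b ^ (p ^ h) - b + ω * a ^ (p ^ h + 1) = 0) :
    phi (p ^ h) ω a b l ∈ stabYinf p h ω := by
  refine ⟨phi_mem_PGU hF hω l hb, ?_⟩
  change phi (p ^ h) ω a b l • Yinf K = Yinf K
  rw [← mk_phiGL, Yinf, Projectivization.PGL.mk_smul_mk,
    Projectivization.mk_eq_mk_iff']
  refine ⟨l ^ (p ^ h + 1), ?_⟩
  change _ = (phiGL (p ^ h) ω a b l).1.mulVec _
  rw [coe_phiGL]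
  ext i
  fin_cases i <;> simp [Matrix.mulVec, dotProduct, Fin.sum_univ_three]

/-- Fixing `Y_∞` clears the middle column off the diagonal. Pairing that column with the first one
kills the lower left entry, and division by the lower right entry leaves the shape of `phiGL`; the
remaining pairings give the other entries and the curve equation. -/
lemma exists_phi_of_mem_stabYinf (hω : ω ≠ 0) {g : PGL(3, K)} (hg : g ∈ stabYinf p h ω) :
    ∃ a b l, b ^ (p ^ h) - b + ω * a ^ (p ^ h + 1) = 0 ∧ g = phi (p ^ h) ω a b l := by
  have hp : p ≠ 0 := (Fact.out : p.Prime).ne_zero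
  obtain ⟨⟨A, hA, rfl⟩, hs⟩ := hg
  change Matrix.ProjGenLinGroup.mk A • Yinf K = Yinf K at hs
  rw [Yinf, Projectivization.PGL.mk_smul_mk, Projectivization.mk_eq_mk_iff'] at hs
  obtain ⟨c, hc⟩ := hs
  change _ = A.1.mulVec _ at hc
  have h01 := congrFun hc 0
  have h21 := congrFun hc 2
  simp [Matrix.mulVec, dotProduct, Fin.sum_univ_three] at h01 h21
  replace hA := mem_GU_iff_form.mp hA
  have e10 := hA 1 0
  have e12 := hA 1 2
  have e00 := hA 0 0
  have e20 := hA 2 0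
  have e22 := hA 2 2
  have e21 := hA 2 1
  simp [form, formMatrix, ← h01, ← h21, hp] at e10 e12 e00 e20 e22 e21
  have hε : A.1 2 2 ≠ 0 := fun h0 => by simp [h0] at e12
  have h11 : A.1 1 1 ≠ 0 := fun h0 => by simp [h0] at e21
  have h20 : A.1 2 0 = 0 := e10.resolve_left h11
  simp [h20, hp] at e00
  have hα : A.1 0 0 ≠ 0 := fun h0 => by simp [h0, hω.symm] at e00
  have hαα : A.1 0 0 ^ p ^ h * A.1 0 0 = 1 := by
    apply mul_left_cancel₀ hω; linear_combination e00
  have hε' : A.1 2 2 ^ p ^ h ≠ 0 := pow_ne_zero _ hε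
  refine ⟨A.1 0 2 / A.1 2 2, A.1 1 2 / A.1 2 2, Units.mk0 _ hα / Units.mk0 _ hε, ?_, ?_⟩
  · rw [div_pow, div_pow, pow_succ (A.1 2 2)]
    field_simp
    linear_combination e22
  · rw [← mk_phiGL, eq_comm, Matrix.ProjGenLinGroup.mk_eq_mk_iff]
    refine ⟨Units.mk0 _ hε, Units.ext ?_⟩
    rw [Units.val_mul, coe_phiGL, Matrix.GeneralLinearGroup.coe_scalar]
    ext i j
    fin_cases i <;> fin_cases j <;>
      simp [Matrix.mul_apply, Fin.sum_univ_three, ← h01, ← h21, h20, div_pow, hε]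
    · field_simp
      linear_combination e20 - A.1 1 2 ^ p ^ h * h20
    · rw [pow_succ, pow_succ]
      field_simp
      linear_combination hαα - e21

/-- The isometry exchanging `(0 : 1 : 0)` and `(0 : 0 : 1)`. -/
def swapGL (K : Type*) [Field K] : GL (Fin 3) K :=
  Matrix.GeneralLinearGroup.mkOfDetNeZero !![1, 0, 0; 0, 0, 1; 0, -1, 0]
    (by simp [Matrix.det_fin_three])

lemma coe_swapGL : (swapGL K : Matrix (Fin 3) (Fin 3) K) = !![1, 0, 0; 0, 0, 1; 0, -1, 0] := rfl

lemma swapGL_mem_GU : swapGL K ∈ GU p h ω := by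
  have hp : p ≠ 0 := (Fact.out : p.Prime).ne_zero
  rw [mem_GU_iff_form, coe_swapGL]
  have : (-1 : K) ^ p ^ h = -1 := by
    simpa [iterateFrobenius_def] using map_neg (iterateFrobenius K p h) 1
  intro i j
  fin_cases i <;> fin_cases j <;> simp [form, formMatrix, hp, this]

/-- Isotropic points lie in one orbit of the projective unitary group. -/
lemma exists_smul_eq_Yinf (hF : ∀ x : K, (x ^ p ^ h) ^ p ^ h = x)
    (hω : ω ^ (p ^ h) = -ω) (hω0 : ω ≠ 0) {v : Fin 3 → K} (hv : v ≠ 0)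
    (hiso : form (p ^ h) ω v v = 0) :
    ∃ g ∈ PGU p h ω, g • Projectivization.mk K v hv = Yinf K := by
  have hp : p ≠ 0 := (Fact.out : p.Prime).ne_zero
  by_cases h2 : v 2 = 0
  · have h0 : v 0 = 0 := by
      simpa [form, h2, hp, hω0] using hiso
    refine ⟨1, one_mem _, ?_⟩
    rw [one_smul, Yinf, Projectivization.mk_eq_mk_iff']
    refine ⟨v 1, ?_⟩
    ext i
    fin_cases i <;> simp [h0, h2]
  · have hv2 : v 2 ^ p ^ h ≠ 0 := pow_ne_zero _ h2
    have hb : (v 1 / v 2) ^ (p ^ h) - v 1 / v 2 + ω * (v 0 / v 2) ^ (p ^ h + 1) = 0 := by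
      rw [div_pow, div_pow, pow_succ (v 2)]
      field_simp
      rw [form] at hiso
      linear_combination hiso
    -- The swap takes `Y_∞` to the affine origin, which the translation carries to the given affine
    -- point.
    have key : (phi (p ^ h) ω (v 0 / v 2) (v 1 / v 2) 1 *
        Matrix.ProjGenLinGroup.mk (swapGL K)) • Yinf K = Projectivization.mk K v hv := by
      rw [← mk_phiGL, ← map_mul, Yinf, Projectivization.PGL.mk_smul_mk,
        Projectivization.mk_eq_mk_iff']
      refine ⟨-(v 2)⁻¹, ?_⟩
      change _ = (phiGL (p ^ h) ω (v 0 / v 2) (v 1 / v 2) 1 * swapGL K).1.mulVec _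
      rw [Units.val_mul, coe_phiGL, coe_swapGL, ← Matrix.mulVec_mulVec]
      ext i
      fin_cases i <;> simp [Matrix.mulVec, dotProduct, Fin.sum_univ_three] <;> field_simp
    refine ⟨(phi (p ^ h) ω (v 0 / v 2) (v 1 / v 2) 1 *
        Matrix.ProjGenLinGroup.mk (swapGL K))⁻¹, inv_mem (mul_mem (phi_mem_PGU hF hω 1 hb)
        ⟨_, swapGL_mem_GU, rfl⟩), ?_⟩
    rw [inv_smul_eq_iff, key]

end Unitary

end Hermitian

/-! ### Diagonalisable endomorphisms conjugated into polynomials in themselves. -/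

section Semisimple

open Polynomial

lemma Polynomial.aeval_units_conj {R A : Type*} [CommRing R] [Ring A] [Algebra R A] (U : Aˣ)
    (a : A) (g : R[X]) : aeval (U * a * ↑U⁻¹) g = U * aeval a g * ↑U⁻¹ := by
  simp only [aeval_eq_sum_range, Units.conj_pow, Finset.mul_sum, Finset.sum_mul, mul_smul_comm,
    smul_mul_assoc]

/-- Conjugation commutes with evaluating polynomials, so each further conjugation by `U` substitutes
`f` once more. When `U ^ p = 1`, this makes `f` periodic on the eigenvalues. -/
lemma Polynomial.aeval_iterate_comp_eq_conj_pow {R A : Type*} [CommRing R] [Ring A] [Algebra R A]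
    {a : A} {U : Aˣ} {f : R[X]} (hf : U * a * ↑U⁻¹ = aeval a f) (n : ℕ) :
    aeval a (f.comp^[n] X) = ↑(U ^ n) * a * ↑(U ^ n)⁻¹ := by
  induction n with
  | zero => simp
  | succ n ih =>
    rw [Function.iterate_succ_apply', aeval_comp, ih, aeval_units_conj, ← hf, pow_succ, mul_inv_rev]
    simp only [Units.val_mul, mul_assoc]

variable {L V : Type*} [Field L] [IsAlgClosed L] [AddCommGroup V] [Module L V]
  [FiniteDimensional L V]

/-- A unit of prime order larger than the dimension that conjugates a diagonalisable endomorphism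
into a polynomial in it commutes with it. -/
lemma Module.End.aeval_eq_self_of_conj {p d : ℕ} (hp : p.Prime)
    (hVp : Module.finrank L V < p) (hd : (d : L) ≠ 0)
    {A : Module.End L V} {U : (Module.End L V)ˣ} {f : L[X]} {c : L} (hc : c ≠ 0)
    (hU : U ^ p = 1) (hA : A ^ d = algebraMap L _ c)
    (hf : U * A * ↑U⁻¹ = aeval A f) : aeval A f = A := by
  classical
  have hm0 : minpoly L A ≠ 0 := minpoly.ne_zero (Algebra.IsIntegral.isIntegral A)
  have hmaps : ∀ t, (minpoly L A).IsRoot t → (minpoly L A).IsRoot (f.eval t) := by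
    intro t ht
    rw [← Module.End.hasEigenvalue_iff_isRoot, Module.End.hasEigenvalue_iff_mem_spectrum] at ht ⊢
    rw [← spectrum.units_conjugate (u := U), hf]
    exact spectrum.subset_polynomial_aeval A f ⟨t, ht, rfl⟩
  have hper : ∀ t, (minpoly L A).IsRoot t → (fun s => f.eval s)^[p] t = t := by
    intro t ht
    have h0 : aeval A (f.comp^[p] X - X) = 0 := by
      rw [map_sub, Polynomial.aeval_iterate_comp_eq_conj_pow hf, hU]
      simp
    have := Polynomial.IsRoot.dvd ht (minpoly.dvd L A h0)
    rw [IsRoot.def, eval_sub, iterate_comp_eval, eval_X, sub_eq_zero] at this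
    exact this
  -- The period of an eigenvalue under `f` divides the prime `p`; period `p` would produce more
  -- eigenvalues than the dimension allows.
  have hfix : ∀ t, (minpoly L A).IsRoot t → f.eval t = t := by
    intro t ht
    have hdvd : Function.minimalPeriod (fun s => f.eval s) t ∣ p :=
      Function.IsPeriodicPt.minimalPeriod_dvd (hper t ht)
    rcases (Nat.dvd_prime hp).mp hdvd with h1 | h1
    · exact Function.minimalPeriod_eq_one_iff_isFixedPt.mp h1
    · exfalso
      have hroot : ∀ n, (minpoly L A).IsRoot ((fun s => f.eval s)^[n] t) := by
        intro n
        induction n with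
        | zero => exact ht
        | succ n ih => rw [Function.iterate_succ_apply']; exact hmaps _ ih
      have hinj := Function.iterate_injOn_Iio_minimalPeriod (f := fun s => f.eval s) (x := t)
      rw [h1] at hinj
      have hle : (Finset.range p).card ≤ (minpoly L A).roots.toFinset.card := by
        refine Finset.card_le_card_of_injOn (fun n => (fun s => f.eval s)^[n] t) ?_ ?_
        · intro n _
          simpa [hm0] using hroot n
        · intro a ha b hb
          exact hinj (by simpa using ha) (by simpa using hb)
      have h2 : (minpoly L A).roots.toFinset.card ≤ Module.finrank L V :=
        calc _ ≤ Multiset.card (minpoly L A).roots := Multiset.toFinset_card_le _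
          _ ≤ (minpoly L A).natDegree := card_roots' _
          _ ≤ A.charpoly.natDegree :=
            natDegree_le_of_dvd (LinearMap.minpoly_dvd_charpoly A) A.charpoly_monic.ne_zero
          _ = _ := A.charpoly_natDegree
      rw [Finset.card_range] at hle
      omega
  -- Since the roots are simple, fixing each of them is enough for `minpoly L A ∣ f - X`.
  have hsep : (minpoly L A).Separable := by
    refine Separable.of_dvd (separable_X_pow_sub_C c hd hc) (minpoly.dvd L A ?_)
    simp [hA]
  have hdvd : minpoly L A ∣ f - X := by
    by_cases h0 : f - X = 0
    · simp [h0]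
    rw [(IsAlgClosed.splits (minpoly L A)).dvd_iff_roots_le_roots hm0 h0,
      Multiset.le_iff_subset (nodup_roots hsep)]
    intro t ht
    rw [mem_roots hm0] at ht
    rw [mem_roots h0, IsRoot.def, eval_sub, eval_X, hfix t ht, sub_self]
  have := aeval_eq_zero_of_dvd_aeval_eq_zero hdvd (minpoly.aeval L A)
  rwa [map_sub, aeval_X, sub_eq_zero] at this

end Semisimple

/-! ### Nilpotent endomorphisms in dimension three. -/

section Nilpotent

variable {F V : Type*} [Field F] [AddCommGroup V] [Module F V]

lemma Module.End.pow_finrank_eq_zero [FiniteDimensional F V] {N : Module.End F V}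
    (hN : IsNilpotent N) : N ^ Module.finrank F V = 0 := by
  have := LinearMap.aeval_self_charpoly N
  rwa [hN.charpoly_eq_X_pow_finrank, map_pow, Polynomial.aeval_X] at this

/-- The last nonzero power of a nonzero nilpotent endomorphism of a space of dimension three has
rank one. -/
lemma Module.End.exists_pow_finrank_range_le_one (hV : Module.finrank F V = 3)
    {N : Module.End F V} (hN : IsNilpotent N) (hN0 : N ≠ 0) :
    ∃ m, N ^ (m + 1) ≠ 0 ∧ N ^ (m + 2) = 0 ∧
      Module.finrank F (LinearMap.range (N ^ (m + 1))) ≤ 1 := by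
  have : FiniteDimensional F V := FiniteDimensional.of_finrank_pos (by omega)
  by_cases h2 : N ^ 2 = 0
  · refine ⟨0, by simpa using hN0, h2, ?_⟩
    have h1 : LinearMap.range N ≤ LinearMap.ker N := by
      rintro _ ⟨x, rfl⟩
      rw [LinearMap.mem_ker, ← Module.End.mul_apply, ← sq, h2, LinearMap.zero_apply]
    have := Submodule.finrank_mono h1
    have := LinearMap.finrank_range_add_finrank_ker N
    rw [zero_add, pow_one]
    omega
  · have h3 : N ^ 3 = 0 := by
      rw [← hV]; exact Module.End.pow_finrank_eq_zero hN
    refine ⟨1, h2, h3, ?_⟩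
    by_contra! hlt
    rw [one_add_one_eq_two] at hlt
    have hle : LinearMap.range (N ^ 2) ≤ LinearMap.range N := by
      rw [sq]; exact LinearMap.range_comp_le_range _ _
    have hker : LinearMap.ker N ≠ ⊥ := by
      intro hk
      apply h2
      rw [LinearMap.ker_eq_bot] at hk
      ext x
      apply hk
      rw [← Module.End.mul_apply, ← pow_succ', h3]
      simp
    have h1 : 0 < Module.finrank F (LinearMap.ker N) :=
      Nat.pos_of_ne_zero fun h0 => hker (Submodule.finrank_eq_zero.mp h0)
    have := LinearMap.finrank_range_add_finrank_ker N
    -- The kernel is nonzero, so the range of `N` has dimension at most two. Equality of the ranges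
    -- then puts `N x` in the range of `N ^ 2`, which `N` kills because `N ^ 3 = 0`.
    have heq : LinearMap.range (N ^ 2) = LinearMap.range N :=
      Submodule.eq_of_le_of_finrank_le hle (by omega)
    apply h2
    ext x
    obtain ⟨y, hy⟩ : N x ∈ LinearMap.range (N ^ 2) := heq ▸ ⟨x, rfl⟩
    rw [sq, Module.End.mul_apply, ← hy, ← Module.End.mul_apply, ← pow_succ', h3,
      LinearMap.zero_apply, LinearMap.zero_apply]

end Nilpotent

/-! ### Lifting to isometries; commutation and the invariant isotropic point. -/

namespace Hermitian

variable {K : Type*} [Field K] {p h : ℕ} [Fact p.Prime] [CharP K p] {ω : K}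

open Matrix Matrix.ProjGenLinGroup

/-- The `p`-th power of any isometric lift is a scalar `c` with `c^(q+1) = 1`. Raising the lift to
the power `q + 1` kills `c`, and leaves `x` unchanged because `p ∣ q`. -/
lemma exists_isometry_of_pow_eq_one (hh : h ≠ 0) {x : PGL(3, K)} (hx : x ∈ PGU p h ω)
    (hxp : x ^ p = 1) : ∃ X ∈ GU p h ω, mk X = x ∧ X ^ p = 1 := by
  obtain ⟨X, hX, rfl⟩ := hx
  rw [← map_pow, mk_eq_one, GeneralLinearGroup.center_eq_range_scalar] at hxp
  obtain ⟨c, hc⟩ := hxp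
  have hc1 : c ^ (p ^ h + 1) = 1 := by
    apply Units.ext
    rw [Units.val_pow_eq_pow_val, Units.val_one]
    apply pow_eq_one_of_scalar_mem_GU (ω := ω)
    rw [hc]
    exact pow_mem hX p
  refine ⟨X ^ (p ^ h + 1), pow_mem hX _, ?_, ?_⟩
  · obtain ⟨k, rfl⟩ := Nat.exists_eq_succ_of_ne_zero hh
    rw [pow_succ X, map_mul, pow_succ', pow_mul, ← hc, ← map_pow, mk_scalar, one_mul]
  · rw [← pow_mul, mul_comm, pow_mul, ← hc, ← map_pow, hc1, map_one]

lemma commute_of_conj_eq_pow (hp3 : 3 < p) {d k : ℕ} (hd : (d : K) ≠ 0) {x y : PGL(3, K)}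
    (hh : h ≠ 0) (hx : x ∈ PGU p h ω) (hxp : x ^ p = 1) (hyd : y ^ d = 1)
    (hxy : x * y * x⁻¹ = y ^ k) : x * y = y * x := by
  obtain ⟨X, -, rfl, hX⟩ := exists_isometry_of_pow_eq_one hh hx hxp
  obtain ⟨Y, rfl⟩ := mk_surjective y
  rw [← map_pow, mk_eq_one, GeneralLinearGroup.center_eq_range_scalar] at hyd
  obtain ⟨c, hc⟩ := hyd
  rw [← map_inv, ← map_mul, ← map_mul, ← map_pow, eq_comm, mk_eq_mk_iff] at hxy
  obtain ⟨μ, hμ⟩ := hxy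
  suffices e : Y ^ k * GeneralLinearGroup.scalar (Fin 3) μ = Y by
    rw [e, eq_mul_inv_iff_mul_eq] at hμ
    rw [← map_mul, ← map_mul, hμ]
  -- The eigenvalues of `Y` need not lie in `K`, so the matrices are transported to the algebraic
  -- closure.
  let L := AlgebraicClosure K
  let Φ : Matrix (Fin 3) (Fin 3) K →+* Module.End L (Fin 3 → L) :=
    (Matrix.toLinAlgEquiv' (R := L) (n := Fin 3)).toRingEquiv.toRingHom.comp
      (RingHom.mapMatrix (algebraMap K L))
  have hΦ : Function.Injective Φ :=
    (Matrix.toLinAlgEquiv' (R := L) (n := Fin 3)).injective.comp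
      (Matrix.map_injective (algebraMap K L).injective)
  have hΦs : ∀ a : K, Φ (Matrix.scalar (Fin 3) a) = algebraMap L _ (algebraMap K L a) := by
    intro a
    have : RingHom.mapMatrix (algebraMap K L) (Matrix.scalar (Fin 3) a) =
        algebraMap L (Matrix (Fin 3) (Fin 3) L) (algebraMap K L a) := by
      ext i j
      simp [Matrix.algebraMap_matrix_apply, Matrix.diagonal_apply, apply_ite (algebraMap K L)]
    rw [RingHom.comp_apply, this]
    exact (Matrix.toLinAlgEquiv' (R := L) (n := Fin 3)).commutes _
  have hconj : (Units.map Φ.toMonoidHom X : Module.End L (Fin 3 → L)) * Φ Y.1 *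
      ↑(Units.map Φ.toMonoidHom X)⁻¹ = Polynomial.aeval (Φ Y.1)
        (Polynomial.C (algebraMap K L μ) * Polynomial.X ^ k) := by
    have := congrArg (fun g : GL (Fin 3) K => Φ g.1) hμ
    simp only [Units.val_mul, map_mul, Units.val_pow_eq_pow_val, map_pow,
      GeneralLinearGroup.coe_scalar, hΦs] at this
    rw [map_mul, map_pow, Polynomial.aeval_X, Polynomial.aeval_C, (Algebra.commutes _ _), this]
    rfl
  have hfin := Module.End.aeval_eq_self_of_conj (p := p) (d := d) Fact.out (by simpa using hp3)
    (by simpa using (map_ne_zero (algebraMap K L)).mpr hd)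
    ((map_ne_zero (algebraMap K L)).mpr c.ne_zero)
    (by rw [← map_pow, hX, map_one])
    (by rw [← hΦs, ← map_pow, ← Units.val_pow_eq_pow_val, ← hc]; rfl) hconj
  apply Units.ext
  apply hΦ
  rw [map_mul, map_pow, Polynomial.aeval_X, Polynomial.aeval_C, (Algebra.commutes _ _),
    ← hΦs] at hfin
  rw [Units.val_mul, Units.val_pow_eq_pow_val, GeneralLinearGroup.coe_scalar, map_mul, map_pow,
    hfin]

/-- Used to see that the range of `X - 1` is orthogonal to its kernel. -/
lemma form_mulVec_sub_one {X : GL (Fin 3) K} (hX : X ∈ GU p h ω) (u v : Fin 3 → K) :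
    form (p ^ h) ω ((X.1 - 1) *ᵥ u) v = -form (p ^ h) ω (X.1 *ᵥ u) ((X.1 - 1) *ᵥ v) := by
  have h1 : form (p ^ h) ω ((X.1 - 1) *ᵥ u) v =
      form (p ^ h) ω (X.1 *ᵥ u) v - form (p ^ h) ω u v := by
    rw [Matrix.sub_mulVec, Matrix.one_mulVec]
    simp only [form, Pi.sub_apply, sub_pow_char_pow]
    ring
  have h2 : form (p ^ h) ω (X.1 *ᵥ u) ((X.1 - 1) *ᵥ v) =
      form (p ^ h) ω (X.1 *ᵥ u) (X.1 *ᵥ v) - form (p ^ h) ω (X.1 *ᵥ u) v := by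
    rw [Matrix.sub_mulVec, Matrix.one_mulVec]
    simp only [form, Pi.sub_apply]
    ring
  rw [h1, h2, form_mulVec hX]
  ring

/-- For a unipotent lift `1 + N` of `x`, the last nonzero power of `N` has a line as image. The line
lies in both the range and the kernel of `N`, so it is isotropic and fixed by `x`. A lift of `y`
conjugates `N` to `N` times a polynomial in `X`, hence preserves the line. -/
lemma exists_isotropic_fixed (hh : h ≠ 0) {x y : PGL(3, K)} {k : ℕ}
    (hx : x ∈ PGU p h ω) (hx1 : x ≠ 1) (hxp : x ^ p = 1) (hyx : y * x * y⁻¹ = x ^ k) :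
    ∃ (v : Fin 3 → K) (hv : v ≠ 0), form (p ^ h) ω v v = 0 ∧
      x • Projectivization.mk K v hv = Projectivization.mk K v hv ∧
      y • Projectivization.mk K v hv = Projectivization.mk K v hv := by
  obtain ⟨X, hX, rfl, hXp⟩ := exists_isometry_of_pow_eq_one hh hx hxp
  obtain ⟨Y, rfl⟩ := mk_surjective y
  rw [← map_inv, ← map_mul, ← map_mul, ← map_pow, eq_comm, mk_eq_mk_iff] at hyx
  obtain ⟨ν, hν⟩ := hyx
  -- Taking `p`-th powers leaves `ν ^ p = 1`, and Frobenius is injective.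
  have hν1 : ν = 1 := by
    have e : (X ^ k * GeneralLinearGroup.scalar (Fin 3) ν) ^ p = 1 := by
      rw [hν, conj_pow, hXp, mul_one, mul_inv_cancel]
    rw [Commute.mul_pow (GeneralLinearGroup.scalar_commute ν _).symm, ← pow_mul, mul_comm k,
      pow_mul, hXp, one_pow, one_mul, ← map_pow] at e
    have e' := congrArg (fun g : GL (Fin 3) K => g.1 0 0) e
    simp only [GeneralLinearGroup.coe_scalar] at e'
    have e1 : (ν : K) ^ p = 1 := by simpa using e'
    apply Units.ext
    exact frobenius_inj K p (by simpa [frobenius_def] using e1)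
  rw [hν1, map_one, mul_one, eq_mul_inv_iff_mul_eq] at hν
  set N : Matrix (Fin 3) (Fin 3) K := X.1 - 1 with hN
  have hNnil : IsNilpotent (Matrix.toLin' N) := by
    refine ⟨p, ?_⟩
    rw [← Matrix.toLin'_pow, hN, sub_pow_char_of_commute _ (Commute.one_right _),
      ← Units.val_pow_eq_pow_val, hXp]
    simp
  have hN0 : Matrix.toLin' N ≠ 0 := by
    intro h0
    replace h0 := sub_eq_zero.mp ((LinearEquiv.map_eq_zero_iff _).mp h0)
    have hX1 : X = 1 := Units.ext h0
    exact hx1 (by rw [hX1, map_one])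
  obtain ⟨m, hm1, hm2, hm3⟩ := Module.End.exists_pow_finrank_range_le_one (by simp) hNnil hN0
  obtain ⟨w, hw⟩ : ∃ w, (Matrix.toLin' N ^ (m + 1)) w ≠ 0 := by
    by_contra! H
    exact hm1 (LinearMap.ext H)
  have hsp : ∀ z, ∃ c : K, c • (Matrix.toLin' N ^ (m + 1)) w = (Matrix.toLin' N ^ (m + 1)) z := by
    intro z
    obtain ⟨v, hv⟩ := finrank_le_one_iff.mp hm3
    obtain ⟨a, ha⟩ := hv ⟨_, w, rfl⟩
    obtain ⟨b, hb⟩ := hv ⟨_, z, rfl⟩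
    rw [Subtype.ext_iff] at ha hb
    simp only [Submodule.coe_smul] at ha hb
    have ha0 : a ≠ 0 := fun h0 => hw (by rw [← ha, h0, zero_smul])
    exact ⟨b * a⁻¹, by rw [← ha, ← hb, smul_smul, inv_mul_cancel_right₀ ha0]⟩
  simp only [← Matrix.toLin'_pow, Matrix.toLin'_apply] at hw hsp hm2
  replace hm2 : N ^ (m + 2) = 0 := (LinearEquiv.map_eq_zero_iff _).mp hm2
  have hNv : N *ᵥ (N ^ (m + 1) *ᵥ w) = 0 := by
    rw [Matrix.mulVec_mulVec, ← pow_succ', hm2, Matrix.zero_mulVec]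
  refine ⟨N ^ (m + 1) *ᵥ w, hw, ?_, ?_, ?_⟩
  · have e : N ^ (m + 1) *ᵥ w = (X.1 - 1) *ᵥ (N ^ m *ᵥ w) := by
      rw [Matrix.mulVec_mulVec, ← hN, ← pow_succ']
    nth_rewrite 1 [e]
    rw [form_mulVec_sub_one hX, ← hN, hNv]
    simp [form]
  · rw [Projectivization.PGL.mk_smul_mk, Projectivization.mk_eq_mk_iff']
    refine ⟨1, ?_⟩
    change _ = X.1 *ᵥ _
    rw [hN, Matrix.sub_mulVec, Matrix.one_mulVec, sub_eq_zero, ← hN] at hNv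
    rw [one_smul, hNv]
  · rw [Projectivization.PGL.mk_smul_mk, Projectivization.mk_eq_mk_iff']
    change ∃ a : K, _ = Y.1 *ᵥ _
    -- The geometric sum commutes with `N`, so powers of the product split and `N ^ (m + 1)` can be
    -- pulled to the left.
    have hU : N * (∑ i ∈ Finset.range k, X.1 ^ i) = X.1 ^ k - 1 := mul_geom_sum _ _
    have hcomm : Commute N (∑ i ∈ Finset.range k, X.1 ^ i) :=
      Commute.sum_right _ _ _ fun i _ =>
        ((Commute.refl X.1).sub_left (Commute.one_left _)).pow_right i
    have hsemi : SemiconjBy Y.1 N (N * ∑ i ∈ Finset.range k, X.1 ^ i) := by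
      have := congrArg Units.val hν
      rw [Units.val_mul, Units.val_mul, Units.val_pow_eq_pow_val] at this
      rw [SemiconjBy, hU, hN, mul_sub, sub_mul, mul_one, one_mul, this]
    have hpow := (hsemi.pow_right (m + 1)).eq
    rw [hcomm.mul_pow, mul_assoc] at hpow
    rw [Matrix.mulVec_mulVec, hpow, ← Matrix.mulVec_mulVec]
    exact hsp _

end Hermitian

/-! ### Groups of order `d * p` and conjugation of cyclic subgroups. -/

section GroupTheory

variable {G : Type*} [Group G]

lemma mem_normalizer_zpowers {x y : G} {k : ℕ} (hx : IsOfFinOrder x)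
    (hyx : y * x * y⁻¹ = x ^ k) :
    y ∈ Subgroup.normalizer (Subgroup.zpowers x : Set G) := by
  rw [Subgroup.mem_normalizer_iff_map_conj_eq, MonoidHom.map_zpowers]
  have e : (MulAut.conj y : G →* G) x = x ^ k := hyx
  rw [e]
  have hfin : Finite (Subgroup.zpowers x) := hx.finite_zpowers
  refine Subgroup.eq_of_le_of_card_ge ?_ ?_
  · rw [Subgroup.zpowers_le]
    exact pow_mem (Subgroup.mem_zpowers x) k
  · rw [Nat.card_zpowers, Nat.card_zpowers, ← hyx]
    exact (SemiconjBy.conj_mk y x).orderOf_eq.le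

lemma isInternalSemidirect_zpowers {x y : G} {k p d : ℕ} (hp : p ≠ 0) (hpd : p.Coprime d)
    (hx : orderOf x = p) (hy : orderOf y = d) (hyx : y * x * y⁻¹ = x ^ k) :
    IsInternalSemidirect (Subgroup.zpowers x ⊔ Subgroup.zpowers y) (Subgroup.zpowers x)
        (Subgroup.zpowers y) ∧
      Nat.card (Subgroup.zpowers x ⊔ Subgroup.zpowers y : Subgroup G) = d * p := by
  set N := Subgroup.zpowers x
  set C := Subgroup.zpowers y
  have hnorm : (N.subgroupOf (N ⊔ C)).Normal := by
    rw [sup_comm]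
    apply Subgroup.normal_subgroupOf_sup_of_le_normalizer
    rw [Subgroup.zpowers_le]
    refine mem_normalizer_zpowers (orderOf_pos_iff.mp ?_) hyx
    omega
  have hcN : Nat.card (N.subgroupOf (N ⊔ C)) = p := by
    rw [Nat.card_congr (Subgroup.subgroupOfEquivOfLe le_sup_left).toEquiv, Nat.card_zpowers, hx]
  have hcC : Nat.card (C.subgroupOf (N ⊔ C)) = d := by
    rw [Nat.card_congr (Subgroup.subgroupOfEquivOfLe le_sup_right).toEquiv, Nat.card_zpowers, hy]
  have hcompl : (N.subgroupOf (N ⊔ C)).IsComplement' (C.subgroupOf (N ⊔ C)) := by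
    apply Subgroup.isComplement'_of_disjoint_and_mul_eq_univ
    · exact Subgroup.disjoint_of_coprime_natCard (by rwa [hcN, hcC])
    · rw [← Subgroup.normal_mul, ← Subgroup.subgroupOf_sup le_sup_left le_sup_right,
        Subgroup.subgroupOf_self, Subgroup.coe_top]
  refine ⟨⟨le_sup_left, le_sup_right, hnorm, hcompl⟩, ?_⟩
  rw [← hcompl.card_mul_card, hcN, hcC, mul_comm]

/-- `⟨x⟩` has index `d`, the smallest prime factor of the group order, and is therefore normal. -/
lemma conj_zpowers_of_lt {H : Subgroup G} {p d : ℕ} (hp : p.Prime) (hd : d.Prime) (hlt : d < p)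
    (hH : Nat.card H = d * p) {x y : G} (hx : x ∈ H) (hy : y ∈ H) (hxp : orderOf x = p) :
    ∃ k : ℕ, y * x * y⁻¹ = x ^ k := by
  have hfin : Finite H := Nat.finite_of_card_ne_zero (by
    rw [hH]; exact mul_ne_zero hd.ne_zero hp.ne_zero)
  let x' : H := ⟨x, hx⟩
  have hx' : orderOf x' = p := by rw [← hxp]; exact Subgroup.orderOf_mk x hx
  have hmin : (d * p).minFac = d := by
    have h1 : (d * p).minFac ≤ d := Nat.minFac_le_of_dvd hd.two_le (dvd_mul_right d p)
    have h2 : (d * p).minFac.Prime := Nat.minFac_prime fun h => hd.one_lt.ne'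
      (Nat.eq_one_of_mul_eq_one_right h)
    rcases h2.dvd_mul.mp (Nat.minFac_dvd (d * p)) with h3 | h3
    · exact (Nat.prime_dvd_prime_iff_eq h2 hd).mp h3
    · have := (Nat.prime_dvd_prime_iff_eq h2 hp).mp h3
      omega
  have hidx : (Subgroup.zpowers x').index = (Nat.card H).minFac := by
    have := (Subgroup.zpowers x').card_mul_index
    rw [Nat.card_zpowers, hx', hH, mul_comm] at this
    rw [hH, hmin]
    exact Nat.eq_of_mul_eq_mul_right hp.pos this
  have hN := Subgroup.normal_of_index_eq_minFac_card hidx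
  have hmem := hN.conj_mem x' (Subgroup.mem_zpowers x') ⟨y, hy⟩
  rw [← (isOfFinOrder_of_finite x').mem_powers_iff_mem_zpowers] at hmem
  obtain ⟨k, hk⟩ := hmem
  exact ⟨k, by simpa using (congrArg Subtype.val hk).symm⟩

lemma exists_generators_of_card_eq_mul {H : Subgroup G} {p d : ℕ} (hp : p.Prime) (hd : d.Prime)
    (hpd : p ≠ d) (hH : Nat.card H = d * p) :
    ∃ x ∈ H, ∃ y ∈ H, orderOf x = p ∧ orderOf y = d ∧
      H = Subgroup.zpowers x ⊔ Subgroup.zpowers y ∧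
      ((∃ k : ℕ, y * x * y⁻¹ = x ^ k) ∨ ∃ k : ℕ, x * y * x⁻¹ = y ^ k) := by
  have hfin : Finite H := Nat.finite_of_card_ne_zero (by
    rw [hH]; exact mul_ne_zero hd.ne_zero hp.ne_zero)
  have := Fact.mk hp
  have := Fact.mk hd
  obtain ⟨⟨x, hx⟩, hxp⟩ := exists_prime_orderOf_dvd_card' (G := H) p (hH ▸ dvd_mul_left p d)
  obtain ⟨⟨y, hy⟩, hyd⟩ := exists_prime_orderOf_dvd_card' (G := H) d (hH ▸ dvd_mul_right d p)
  rw [Subgroup.orderOf_mk] at hxp hyd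
  refine ⟨x, hx, y, hy, hxp, hyd, ?_, ?_⟩
  · symm
    have hle : Subgroup.zpowers x ⊔ Subgroup.zpowers y ≤ H :=
      sup_le (by simpa using hx) (by simpa using hy)
    have hfin' : Finite (Subgroup.zpowers x ⊔ Subgroup.zpowers y : Subgroup G) :=
      Finite.Set.subset _ hle
    refine Subgroup.eq_of_le_of_card_ge hle ?_
    rw [hH]
    refine Nat.le_of_dvd Nat.card_pos (Nat.Coprime.mul_dvd_of_dvd_of_dvd
      ((Nat.coprime_primes hd hp).mpr hpd.symm) ?_ ?_)
    · rw [← hyd, ← Nat.card_zpowers]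
      exact Subgroup.card_dvd_of_le le_sup_right
    · rw [← hxp, ← Nat.card_zpowers]
      exact Subgroup.card_dvd_of_le le_sup_left
  · rcases lt_or_gt_of_ne hpd with hlt | hlt
    · exact Or.inr (conj_zpowers_of_lt hd hp hlt (by rw [hH, mul_comm]) hy hx hyd)
    · exact Or.inl (conj_zpowers_of_lt hp hd hlt hH hx hy hxp)

/-- Allows the generator of the diagonal factor to be replaced by one of its powers. -/
lemma pow_mul_conj_eq_pow {x y : G} {k : ℕ} (hyx : y * x * y⁻¹ = x ^ k) (j : ℕ) :
    y ^ j * x * (y ^ j)⁻¹ = x ^ k ^ j := by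
  induction j with
  | zero => simp
  | succ j ih =>
    calc y ^ (j + 1) * x * (y ^ (j + 1))⁻¹ = y * (y ^ j * x * (y ^ j)⁻¹) * y⁻¹ := by group
      _ = _ := by rw [ih, ← conj_pow, hyx, ← pow_mul, pow_succ']

lemma map_conj_zpowers_sup (g x y : G) :
    (Subgroup.zpowers x ⊔ Subgroup.zpowers y).map (MulAut.conj g).toMonoidHom =
      Subgroup.zpowers (g * x * g⁻¹) ⊔ Subgroup.zpowers (g * y * g⁻¹) := by
  rw [Subgroup.map_sup, MonoidHom.map_zpowers, MonoidHom.map_zpowers]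
  rfl

lemma ConjugateIn.trans {P H H' H'' : Subgroup G} (h₁ : ConjugateIn P H H')
    (h₂ : ConjugateIn P H' H'') : ConjugateIn P H H'' := by
  obtain ⟨g, hg, rfl⟩ := h₁
  obtain ⟨g', hg', rfl⟩ := h₂
  refine ⟨g' * g, mul_mem hg' hg, ?_⟩
  rw [Subgroup.map_map]
  congr 1
  ext z
  simp

end GroupTheory

/-! ### The prime field, the norm, and elements of order `d`. -/

section FiniteField

variable {K : Type*} [Field K]

/-- The residues `0, …, p - 1` already exhaust the roots of `X^p - X`. -/
lemma exists_natCast_eq_of_pow_eq_self (p : ℕ) [Fact p.Prime] [CharP K p] {x : K}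
    (hx : x ^ p = x) : ∃ k : ℕ, (k : K) = x := by
  classical
  have hp : p.Prime := Fact.out
  have hne : (Polynomial.X ^ p - Polynomial.X : Polynomial K) ≠ 0 :=
    FiniteField.X_pow_card_sub_X_ne_zero K hp.one_lt
  have hsub : (Finset.range p).image (Nat.cast : ℕ → K) ⊆
      (Polynomial.X ^ p - Polynomial.X : Polynomial K).roots.toFinset := by
    intro z hz
    obtain ⟨k, -, rfl⟩ := Finset.mem_image.mp hz
    simp only [Multiset.mem_toFinset, Polynomial.mem_roots hne, Polynomial.IsRoot.def,
      Polynomial.eval_sub, Polynomial.eval_pow, Polynomial.eval_X, sub_eq_zero]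
    rw [← frobenius_def, map_natCast]
  have hcard : ((Finset.range p).image (Nat.cast : ℕ → K)).card = p := by
    rw [Finset.card_image_of_injOn, Finset.card_range]
    simpa using CharP.natCast_injOn_Iio K p
  have heq := Finset.eq_of_subset_of_card_le hsub (by
    rw [hcard]
    refine (Multiset.toFinset_card_le _).trans ((Polynomial.card_roots' _).trans ?_)
    rw [FiniteField.X_pow_card_sub_X_natDegree_eq K hp.one_lt])
  have hmem : x ∈ (Polynomial.X ^ p - Polynomial.X : Polynomial K).roots.toFinset := by
    simp [Polynomial.mem_roots hne, hx]
  rw [← heq] at hmem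
  obtain ⟨k, -, hk⟩ := Finset.mem_image.mp hmem
  exact ⟨k, hk⟩

/-- Write `b = g ^ j` for a generator `g` of order `(q - 1)(q + 1)`; since `b^(q-1) = 1`, the
exponent `j` is divisible by `q + 1`. -/
lemma exists_pow_succ_eq [Finite K] {q : ℕ} (hq : 1 < q) (hK : Nat.card K = q ^ 2) {b : K}
    (hb0 : b ≠ 0) (hb : b ^ q = b) : ∃ m : Kˣ, (m : K) ^ (q + 1) = b := by
  obtain ⟨g, hg⟩ := IsCyclic.exists_generator (α := Kˣ)
  have hgo : orderOf g = (q - 1) * (q + 1) := by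
    rw [orderOf_eq_card_of_forall_mem_zpowers hg, Nat.card_units, hK, mul_comm, ← Nat.sq_sub_sq,
      one_pow]
  obtain ⟨j, hj⟩ := (isOfFinOrder_of_finite g).mem_powers_iff_mem_zpowers.mpr
    (hg (Units.mk0 b hb0))
  have h1 : g ^ (j * (q - 1)) = 1 := by
    have : g ^ j = Units.mk0 b hb0 := hj
    rw [pow_mul, this]
    apply Units.ext
    apply mul_right_cancel₀ hb0
    simp only [Units.val_pow_eq_pow_val, Units.val_mk0, Units.val_one, one_mul]
    rw [← pow_succ, Nat.sub_add_cancel hq.le, hb]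
  have h2 := orderOf_dvd_of_pow_eq_one h1
  rw [hgo, mul_comm] at h2
  obtain ⟨i, rfl⟩ := Nat.dvd_of_mul_dvd_mul_right (by omega) h2
  refine ⟨g ^ i, ?_⟩
  have := congrArg Units.val hj
  simp only [Units.val_pow_eq_pow_val, Units.val_mk0] at this ⊢
  rw [← this, ← pow_mul, mul_comm]

end FiniteField

lemma exists_pow_eq_of_orderOf_eq {K : Type*} [Field K] {d : ℕ} (hd : d.Prime) {l l' : Kˣ}
    (hl : orderOf l = d) (hl' : orderOf l' = d) : ∃ j : ℕ, l ^ j = l' := by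
  have : NeZero d := ⟨hd.ne_zero⟩
  have hprim : IsPrimitiveRoot (l : K) d :=
    IsPrimitiveRoot.coe_units_iff.mpr (hl ▸ IsPrimitiveRoot.orderOf l)
  obtain ⟨j, -, hj⟩ := hprim.eq_pow_of_pow_eq_one (ξ := (l' : K)) (by
    rw [← Units.val_pow_eq_pow_val, ← hl', pow_orderOf_eq_one, Units.val_one])
  exact ⟨j, Units.ext (by simpa using hj)⟩

/-! ### Normal form inside the stabiliser of `Y_∞`. -/

namespace Hermitian

lemma two_ne_zero_of_three_lt {K : Type*} [Field K] {p : ℕ} [CharP K p] (hp3 : 3 < p) :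
    (2 : K) ≠ 0 := by
  intro h2
  have := (CharP.cast_eq_zero_iff K p 2).mp (by exact_mod_cast h2)
  exact absurd (Nat.le_of_dvd two_pos this) (by omega)

variable {K : Type*} [Field K] {p h : ℕ} [Fact p.Prime] [CharP K p] {ω : K}

lemma phi_translation_pow_char (hp3 : 3 < p) (a b : K) : phi (p ^ h) ω a b 1 ^ p = 1 := by
  have hc : ((p.choose 2 : ℕ) : K) = 0 := (CharP.cast_eq_zero_iff K p _).mpr
    ((Fact.out : p.Prime).dvd_choose_self two_ne_zero (by omega))
  rw [phi_translation_pow, phi_eq_one_iff]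
  simp [hc]

lemma units_eq_one_of_pow_char {l : Kˣ} (hl : l ^ p = 1) : l = 1 := by
  apply Units.ext
  apply frobenius_inj K p
  simpa [frobenius_def] using congrArg Units.val hl

lemma orderOf_of_phi_pow_eq_one (hp3 : 3 < p) {d : ℕ} (hd : d.Prime) (hpd : p ≠ d) {a b : K}
    {l : Kˣ} (h1 : phi (p ^ h) ω a b l ≠ 1) (hφ : phi (p ^ h) ω a b l ^ d = 1) :
    orderOf l = d := by
  have := Fact.mk hd
  apply orderOf_eq_prime
  · obtain ⟨a', b', e⟩ := exists_phi_pow p h ω a b l d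
    rw [hφ, eq_comm, phi_eq_one_iff] at e
    exact e.2.2
  · rintro rfl
    apply h1
    rw [← orderOf_eq_one_iff]
    exact Nat.eq_one_of_dvd_coprimes ((Nat.coprime_primes Fact.out hd).mpr hpd)
      (orderOf_dvd_of_pow_eq_one (phi_translation_pow_char hp3 a b)) (orderOf_dvd_of_pow_eq_one hφ)

lemma curve_of_phi_mem_stabYinf (hω0 : ω ≠ 0) {a b : K} {l : Kˣ}
    (hφ : phi (p ^ h) ω a b l ∈ stabYinf p h ω) :
    b ^ p ^ h - b + ω * a ^ (p ^ h + 1) = 0 := by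
  obtain ⟨a', b', l', hc, e⟩ := exists_phi_of_mem_stabYinf hω0 hφ
  obtain ⟨rfl, rfl, -⟩ := phi_injective e
  exact hc

/-- An element of prime order `d ≠ p` of the stabiliser of `Y_∞` is conjugate to a diagonal
one. -/
lemma exists_conj_eq_phi_diag (hF : ∀ x : K, (x ^ p ^ h) ^ p ^ h = x) (hω : ω ^ p ^ h = -ω)
    (hω0 : ω ≠ 0) (hp3 : 3 < p) {d : ℕ} (hd : d.Prime) (hpd : p ≠ d) {y : PGL(3, K)}
    (hy : y ∈ stabYinf p h ω) (hyd : orderOf y = d) :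
    ∃ g ∈ stabYinf p h ω, ∃ l : Kˣ, orderOf l = d ∧ g * y * g⁻¹ = phi (p ^ h) ω 0 0 l := by
  have hp : p ≠ 0 := (Fact.out : p.Prime).ne_zero
  have h2 : (2 : K) ≠ 0 := two_ne_zero_of_three_lt hp3
  have hd0 : (d : K) ≠ 0 := by
    rw [Ne, CharP.cast_eq_zero_iff K p, Nat.prime_dvd_prime_iff_eq Fact.out hd]
    exact hpd
  obtain ⟨a, b, l, -, rfl⟩ := exists_phi_of_mem_stabYinf hω0 hy
  have hl : orderOf l = d := orderOf_of_phi_pow_eq_one (h := h) (ω := ω) hp3 hd hpd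
    (fun e => by rw [e, orderOf_one] at hyd; exact hd.one_lt.ne hyd)
    (by rw [← hyd, pow_orderOf_eq_one])
  have hl1 : (l : K) - 1 ≠ 0 := by
    rw [sub_ne_zero, Ne, Units.val_eq_one]
    rintro rfl
    rw [orderOf_one] at hl
    exact hd.one_lt.ne hl
  -- Chosen so that conjugation makes the first coordinate vanish; `ω s^(q+1) / 2` is a second
  -- coordinate that puts the translation on the curve.
  set s : K := a / (l - 1) with hs
  have hg₁ : phi (p ^ h) ω s (ω * s ^ (p ^ h + 1) / 2) 1 ∈ stabYinf p h ω := by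
    apply phi_mem_stabYinf hF hω
    have e2 : (2 : K) ^ p ^ h = 2 := by
      rw [← iterateFrobenius_def, map_ofNat]
    rw [div_pow, mul_pow, hω, pow_succ, mul_pow, hF, e2]
    field_simp
    ring
  obtain ⟨b', hb'⟩ := exists_phi_conj p h ω s (ω * s ^ (p ^ h + 1) / 2) a b l
  have hs0 : a + s - l * s = 0 := by
    rw [hs]; field_simp; ring
  rw [hs0] at hb'
  have hmem : phi (p ^ h) ω 0 b' l ∈ stabYinf p h ω := by
    rw [← hb']
    exact mul_mem (mul_mem hg₁ hy) (inv_mem hg₁)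
  have hb'q : b' ^ p ^ h = b' := by
    simpa [sub_eq_zero] using curve_of_phi_mem_stabYinf hω0 hmem
  -- If `l` has norm `1`, the `d`-th power has second coordinate `d * b'`, so `b' = 0` already.
  -- Otherwise a vertical translation removes `b'`; it is unitary because `b'` and the norm of `l`
  -- are fixed by `x ↦ x^q`.
  by_cases hn : (l : K) ^ (p ^ h + 1) = 1
  · refine ⟨_, hg₁, l, hl, ?_⟩
    have e : phi (p ^ h) ω 0 b' l ^ d = 1 := by
      rw [← hb', conj_pow, ← hyd, pow_orderOf_eq_one, mul_one, mul_inv_cancel]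
    rw [phi_vertical_pow p h ω b' l hn, phi_eq_one_iff] at e
    rw [hb', (mul_eq_zero.mp e.2.1).resolve_left hd0]
  · have hn' : (l : K) ^ (p ^ h + 1) - 1 ≠ 0 := sub_ne_zero.mpr hn
    set t : K := b' / (l ^ (p ^ h + 1) - 1) with ht
    have hg₂ : phi (p ^ h) ω 0 t 1 ∈ stabYinf p h ω := by
      apply phi_mem_stabYinf hF hω
      rw [ht, div_pow, sub_pow_char_pow, hb'q, one_pow, pow_succ, mul_pow, hF, mul_comm (l : K)]
      simp
    refine ⟨_, mul_mem hg₂ hg₁, l, hl, ?_⟩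
    have e : b' + t - l ^ (p ^ h + 1) * t = 0 := by
      rw [ht]; field_simp; ring
    have hconj := phi_vertical_conj p h ω t b' l
    rw [e, ← hb'] at hconj
    rw [← hconj]
    group

/-- Normal form, up to conjugacy, of the subgroups of order `d * p`. -/
lemma exists_conj_eq_zpowers_sup (hF : ∀ x : K, (x ^ p ^ h) ^ p ^ h = x) (hω : ω ^ p ^ h = -ω)
    (hω0 : ω ≠ 0) (hh : h ≠ 0) (hp3 : 3 < p) {d : ℕ} (hd : d.Prime) (hpd : p ≠ d)
    {H : Subgroup PGL(3, K)} (hHle : H ≤ PGU p h ω) (hH : Nat.card H = d * p) :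
    ∃ (a b : K) (l : Kˣ) (k : ℕ), orderOf l = d ∧ (a ≠ 0 ∨ b ≠ 0) ∧
      b ^ p ^ h - b + ω * a ^ (p ^ h + 1) = 0 ∧
      phi (p ^ h) ω 0 0 l * phi (p ^ h) ω a b 1 * (phi (p ^ h) ω 0 0 l)⁻¹ =
        phi (p ^ h) ω a b 1 ^ k ∧
      ConjugateIn (PGU p h ω) H
        (Subgroup.zpowers (phi (p ^ h) ω a b 1) ⊔ Subgroup.zpowers (phi (p ^ h) ω 0 0 l)) := by
  have hp : p.Prime := Fact.out
  have hd0 : (d : K) ≠ 0 := by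
    rw [Ne, CharP.cast_eq_zero_iff K p, Nat.prime_dvd_prime_iff_eq Fact.out hd]
    exact hpd
  obtain ⟨x, hx, y, hy, hxp, hyd, rfl, hnorm⟩ := exists_generators_of_card_eq_mul hp hd hpd hH
  have hx1 : x ≠ 1 := by
    rintro rfl
    rw [orderOf_one] at hxp
    exact hp.one_lt.ne hxp
  have hxp' : x ^ p = 1 := by rw [← hxp, pow_orderOf_eq_one]
  have hyd' : y ^ d = 1 := by rw [← hyd, pow_orderOf_eq_one]
  obtain ⟨k, hk⟩ : ∃ k : ℕ, y * x * y⁻¹ = x ^ k := by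
    rcases hnorm with hk | ⟨k, hk⟩
    · exact hk
    · refine ⟨1, ?_⟩
      rw [← commute_of_conj_eq_pow hp3 hd0 hh (hHle hx) hxp' hyd' hk, pow_one,
        mul_inv_cancel_right]
  obtain ⟨v, hv, hiso, hxv, hyv⟩ := exists_isotropic_fixed hh (hHle hx) hx1 hxp' hk
  obtain ⟨g, hg, hgv⟩ := exists_smul_eq_Yinf hF hω hω0 hv hiso
  have hstab : ∀ z ∈ PGU p h ω, z • Projectivization.mk K v hv = Projectivization.mk K v hv →
      g * z * g⁻¹ ∈ stabYinf p h ω := by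
    intro z hz hzv
    have hmem : g * z * g⁻¹ ∈ PGU p h ω := mul_mem (mul_mem hg hz) (inv_mem hg)
    refine ⟨hmem, ?_⟩
    change (g * z * g⁻¹) • Yinf K = Yinf K
    rw [mul_smul, mul_smul, ← hgv, inv_smul_smul, hzv]
  obtain ⟨g', hg', l, hl, hgl⟩ := exists_conj_eq_phi_diag hF hω hω0 hp3 hd hpd
    (hstab y (hHle hy) hyv) (by rw [← hyd]; exact (SemiconjBy.conj_mk g y).orderOf_eq.symm)
  have hxs : g' * (g * x * g⁻¹) * g'⁻¹ ∈ stabYinf p h ω :=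
    mul_mem (mul_mem hg' (hstab x (hHle hx) hxv)) (inv_mem hg')
  obtain ⟨a, b, l', hc, hab⟩ := exists_phi_of_mem_stabYinf hω0 hxs
  have hgx : g' * (g * x * g⁻¹) * g'⁻¹ = (g' * g) * x * (g' * g)⁻¹ := by group
  have hgy : g' * (g * y * g⁻¹) * g'⁻¹ = (g' * g) * y * (g' * g)⁻¹ := by group
  rw [hgx] at hab
  rw [hgy] at hgl
  -- The multiplier of an element of order `p` is a `p`-th root of unity in characteristic `p`.
  have hl' : l' = 1 := by
    obtain ⟨a', b', e⟩ := exists_phi_pow p h ω a b l' p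
    rw [← hab, conj_pow, hxp', mul_one, mul_inv_cancel, eq_comm, phi_eq_one_iff] at e
    exact units_eq_one_of_pow_char e.2.2
  subst hl'
  refine ⟨a, b, l, k, hl, ?_, hc, ?_, g' * g, mul_mem hg'.1 hg, ?_⟩
  · by_contra! h0
    rw [h0.1, h0.2, phi_one] at hab
    exact hx1 (conj_eq_one_iff.mp hab)
  · rw [← hab, ← hgl, conj_pow, ← hk]
    group
  · rw [map_conj_zpowers_sup, hab, hgl]

lemma zpowers_phi_diag_eq {d : ℕ} (hd : d.Prime) {l l' : Kˣ} (hl : orderOf l = d)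
    (hl' : orderOf l' = d) :
    Subgroup.zpowers (phi (p ^ h) ω 0 0 l) = Subgroup.zpowers (phi (p ^ h) ω 0 0 l') := by
  have key : ∀ {l l' : Kˣ}, orderOf l = d → orderOf l' = d →
      Subgroup.zpowers (phi (p ^ h) ω 0 0 l') ≤ Subgroup.zpowers (phi (p ^ h) ω 0 0 l) := by
    intro l l' hl hl'
    obtain ⟨j, hj⟩ := exists_pow_eq_of_orderOf_eq hd hl hl'
    rw [Subgroup.zpowers_le, ← hj, ← phi_diag_pow]
    exact pow_mem (Subgroup.mem_zpowers _) j
  exact le_antisymm (key hl' hl) (key hl hl')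

end Hermitian

/-! ### Reduction to the representatives, and their structure. -/

namespace Hermitian

lemma orderOf_dvd_sub_one_of_pow_eq {K : Type*} [Field K] {p : ℕ} [Fact p.Prime] {u : Kˣ}
    (hu : (u : K) ^ p = u) : orderOf u ∣ p - 1 := by
  apply orderOf_dvd_of_pow_eq_one
  apply Units.ext
  apply mul_right_cancel₀ u.ne_zero
  rw [Units.val_pow_eq_pow_val, ← pow_succ, Nat.sub_add_cancel (Fact.out : p.Prime).pos, hu,
    Units.val_one, one_mul]

variable {K : Type*} [Field K] {p h : ℕ} [Fact p.Prime] [CharP K p] {ω : K}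

lemma conjugateIn_phi_diag (hF : ∀ x : K, (x ^ p ^ h) ^ p ^ h = x) (hω : ω ^ p ^ h = -ω)
    (a b : K) (l m : Kˣ) :
    ConjugateIn (PGU p h ω)
      (Subgroup.zpowers (phi (p ^ h) ω a b 1) ⊔ Subgroup.zpowers (phi (p ^ h) ω 0 0 l))
      (Subgroup.zpowers (phi (p ^ h) ω (m * a) (m ^ (p ^ h + 1) * b) 1) ⊔
        Subgroup.zpowers (phi (p ^ h) ω 0 0 l)) := by
  have hp : p ≠ 0 := (Fact.out : p.Prime).ne_zero
  refine ⟨phi (p ^ h) ω 0 0 m, phi_mem_PGU hF hω m (by simp [hp]), ?_⟩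
  rw [map_conj_zpowers_sup, phi_diag_conj, phi_diag_conj, mul_zero, mul_zero]

/-- Reduction of the normal form to one of the representatives. -/
lemma conjugateIn_representative [Finite K] (hK : Nat.card K = (p ^ h) ^ 2) (hh : h ≠ 0)
    (hF : ∀ x : K, (x ^ p ^ h) ^ p ^ h = x) (hω : ω ^ p ^ h = -ω) (hp3 : 3 < p)
    {d : ℕ} (hd : d.Prime) {a b : K} {l : Kˣ} {k : ℕ} (hl : orderOf l = d)
    (hab : a ≠ 0 ∨ b ≠ 0) (hc : b ^ p ^ h - b + ω * a ^ (p ^ h + 1) = 0)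
    (hk : phi (p ^ h) ω 0 0 l * phi (p ^ h) ω a b 1 * (phi (p ^ h) ω 0 0 l)⁻¹ =
      phi (p ^ h) ω a b 1 ^ k) :
    (d ∣ p ^ h + 1 ∧ ConjugateIn (PGU p h ω)
      (Subgroup.zpowers (phi (p ^ h) ω a b 1) ⊔ Subgroup.zpowers (phi (p ^ h) ω 0 0 l))
      (centralGroup (p ^ h) ω l)) ∨
    (d ∣ p - 1 ∧ ConjugateIn (PGU p h ω)
      (Subgroup.zpowers (phi (p ^ h) ω a b 1) ⊔ Subgroup.zpowers (phi (p ^ h) ω 0 0 l))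
      (centralGroup (p ^ h) ω l)) ∨
    (d ∣ p - 1 ∧ ConjugateIn (PGU p h ω)
      (Subgroup.zpowers (phi (p ^ h) ω a b 1) ⊔ Subgroup.zpowers (phi (p ^ h) ω 0 0 l))
      (noncentralGroup (p ^ h) ω l)) := by
  have hp : p.Prime := Fact.out
  have h2 : NeZero (2 : K) := ⟨two_ne_zero_of_three_lt hp3⟩
  have hl1 : (l : K) ≠ 1 := by
    rw [Ne, Units.val_eq_one]
    rintro rfl
    rw [orderOf_one] at hl
    exact hd.one_lt.ne hl
  rw [phi_diag_conj, phi_translation_pow] at hk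
  obtain ⟨e1, e2, -⟩ := phi_injective hk
  by_cases ha : a = 0
  · subst ha
    have hb : b ≠ 0 := hab.resolve_left (not_not_intro rfl)
    have hbq : b ^ p ^ h = b := by simpa [sub_eq_zero] using hc
    have hlk : (l : K) ^ (p ^ h + 1) = k := by
      apply mul_right_cancel₀ hb
      simpa using e2
    have hdvd : d ∣ p ^ h + 1 ∨ d ∣ p - 1 := by
      rw [← hd.dvd_mul, ← hl]
      apply orderOf_dvd_of_pow_eq_one
      rw [pow_mul]
      apply orderOf_dvd_iff_pow_eq_one.mp
      apply orderOf_dvd_sub_one_of_pow_eq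
      rw [Units.val_pow_eq_pow_val, hlk, ← frobenius_def, map_natCast]
    -- A diagonal map with multiplier `m` scales `b` by the norm of `m`, so an `m` of norm `b⁻¹` is
    -- needed.
    obtain ⟨m, hm⟩ := exists_pow_succ_eq (Nat.one_lt_pow hh hp.one_lt) hK (inv_ne_zero hb)
      (by rw [inv_pow, hbq])
    have hconj := conjugateIn_phi_diag hF hω 0 b l m
    rw [mul_zero, hm, inv_mul_cancel₀ hb] at hconj
    rcases hdvd with hdvd | hdvd
    · exact Or.inl ⟨hdvd, hconj⟩
    · exact Or.inr (Or.inl ⟨hdvd, hconj⟩)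
  · have hlk : (l : K) = k := mul_right_cancel₀ ha e1
    have hlq : (l : K) ^ p ^ h = l := by
      rw [hlk, ← iterateFrobenius_def, map_natCast]
    have hdvd : d ∣ p - 1 := by
      rw [← hl]
      apply orderOf_dvd_sub_one_of_pow_eq
      rw [hlk, ← frobenius_def, map_natCast]
    -- With `k = l` and `l^(q+1) = l^2`, the second coordinate gives `l (l - 1) b = l (l - 1) ω
    -- a^(q+1) / 2`, and `l ≠ 1`.
    have hb : b = ω * a ^ (p ^ h + 1) / 2 := by
      rw [Nat.cast_choose_two, ← hlk, pow_succ (l : K), hlq] at e2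
      apply mul_left_cancel₀ (mul_ne_zero l.ne_zero (sub_ne_zero.mpr hl1))
      linear_combination e2
    have hconj := conjugateIn_phi_diag hF hω a b l (Units.mk0 a ha)⁻¹
    have e3 : ((Units.mk0 a ha)⁻¹ : Kˣ) * a = (1 : K) := by simp [ha]
    have e4 : (((Units.mk0 a ha)⁻¹ : Kˣ) : K) ^ (p ^ h + 1) * b = ω / 2 := by
      rw [hb, Units.val_inv_eq_inv_val, Units.val_mk0, inv_pow]
      field_simp
    rw [e3, e4] at hconj
    exact Or.inr (Or.inr ⟨hdvd, hconj⟩)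

lemma orderOf_phi_translation (hp3 : 3 < p) {a b : K} (hab : a ≠ 0 ∨ b ≠ 0) :
    orderOf (phi (p ^ h) ω a b 1) = p :=
  orderOf_eq_prime (phi_translation_pow_char hp3 a b) fun e => by
    rw [phi_eq_one_iff] at e
    tauto

lemma orderOf_phi_diag (l : Kˣ) : orderOf (phi (p ^ h) ω 0 0 l) = orderOf l :=
  orderOf_eq_orderOf_iff.mpr fun n => by
    rw [phi_diag_pow, phi_eq_one_iff]
    simp

lemma zpowers_sup_le_stabYinf (hF : ∀ x : K, (x ^ p ^ h) ^ p ^ h = x) (hω : ω ^ p ^ h = -ω)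
    {a b : K} (hc : b ^ p ^ h - b + ω * a ^ (p ^ h + 1) = 0) (l : Kˣ) :
    Subgroup.zpowers (phi (p ^ h) ω a b 1) ⊔ Subgroup.zpowers (phi (p ^ h) ω 0 0 l) ≤
      stabYinf p h ω := by
  have hp : p ≠ 0 := (Fact.out : p.Prime).ne_zero
  refine sup_le ?_ ?_ <;> rw [Subgroup.zpowers_le]
  · exact phi_mem_stabYinf hF hω 1 hc
  · exact phi_mem_stabYinf hF hω l (by simp [hp])

lemma noncentral_curve (hω : ω ^ p ^ h = -ω) (hp3 : 3 < p) :
    (ω / 2) ^ p ^ h - ω / 2 + ω * 1 ^ (p ^ h + 1) = 0 := by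
  have h2 : (2 : K) ≠ 0 := two_ne_zero_of_three_lt hp3
  have e2 : (2 : K) ^ p ^ h = 2 := by rw [← iterateFrobenius_def, map_ofNat]
  rw [div_pow, hω, e2]
  field_simp
  ring

lemma exists_natCast_of_orderOf_dvd {l : Kˣ} (hl : orderOf l ∣ p - 1) :
    ∃ k : ℕ, (k : K) = l := by
  apply exists_natCast_eq_of_pow_eq_self p
  rw [← Nat.sub_add_cancel (Fact.out : p.Prime).pos, pow_succ, ← Units.val_pow_eq_pow_val,
    orderOf_dvd_iff_pow_eq_one.mp hl, Units.val_one, one_mul]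

lemma centralGroup_of_dvd_succ (hF : ∀ x : K, (x ^ p ^ h) ^ p ^ h = x) (hω : ω ^ p ^ h = -ω)
    (hp3 : 3 < p) {d : ℕ} (hd : d.Prime) (hpd : p ≠ d) {l : Kˣ} (hl : orderOf l = d)
    (hdvd : d ∣ p ^ h + 1) :
    centralGroup (p ^ h) ω l ≤ stabYinf p h ω ∧ Nat.card (centralGroup (p ^ h) ω l) = d * p ∧
      IsInternalDirect (centralGroup (p ^ h) ω l) (sigmaCentral (p ^ h) ω)
        (sigmaDiag (p ^ h) ω l) ∧ IsCyclic (centralGroup (p ^ h) ω l) := by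
  have hp : p.Prime := Fact.out
  have hcop : p.Coprime d := (Nat.coprime_primes hp hd).mpr hpd
  have hx : orderOf (phi (p ^ h) ω 0 1 1) = p := orderOf_phi_translation hp3 (by simp)
  have hy : orderOf (phi (p ^ h) ω 0 0 l) = d := (orderOf_phi_diag l).trans hl
  have hlq : (l : K) ^ (p ^ h + 1) = 1 := by
    rw [← Units.val_pow_eq_pow_val, orderOf_dvd_iff_pow_eq_one.mp (hl ▸ hdvd), Units.val_one]
  have hyx : phi (p ^ h) ω 0 0 l * phi (p ^ h) ω 0 1 1 * (phi (p ^ h) ω 0 0 l)⁻¹ =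
      phi (p ^ h) ω 0 1 1 := by
    rw [phi_diag_conj, hlq, mul_zero, mul_one]
  have hcomm : Commute (phi (p ^ h) ω 0 1 1) (phi (p ^ h) ω 0 0 l) :=
    (mul_inv_eq_iff_eq_mul.mp hyx).symm
  have hxy : phi (p ^ h) ω 0 1 1 * phi (p ^ h) ω 0 0 l * (phi (p ^ h) ω 0 1 1)⁻¹ =
      phi (p ^ h) ω 0 0 l ^ 1 := by
    rw [hcomm.eq, mul_inv_cancel_right, pow_one]
  obtain ⟨hsd, hcard⟩ := isInternalSemidirect_zpowers hp.ne_zero hcop hx hy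
    (hyx.trans (pow_one _).symm)
  obtain ⟨hsd', -⟩ := isInternalSemidirect_zpowers hd.ne_zero hcop.symm hy hx hxy
  rw [sup_comm] at hsd'
  refine ⟨zpowers_sup_le_stabYinf hF hω (by simp) l, hcard, ⟨hsd, hsd'.2.2.1⟩, ?_⟩
  have hfin : Finite (centralGroup (p ^ h) ω l) := Nat.finite_of_card_ne_zero (by
    rw [centralGroup, sigmaCentral, sigmaDiag, hcard]
    exact mul_ne_zero hd.ne_zero hp.ne_zero)
  refine isCyclic_of_orderOf_eq_card (⟨phi (p ^ h) ω 0 1 1 * phi (p ^ h) ω 0 0 l,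
    mul_mem (hsd.1 (Subgroup.mem_zpowers _)) (hsd.2.1 (Subgroup.mem_zpowers _))⟩ :
    centralGroup (p ^ h) ω l) ?_
  rw [Subgroup.orderOf_mk, hcomm.orderOf_mul_eq_mul_orderOf_of_coprime (by rwa [hx, hy]), hx, hy,
    mul_comm]
  exact hcard.symm

/-- Here `l` lies in the prime field, so its norm is `l^2`; commutativity would force `l^2 = 1`,
which `d > 2` excludes. -/
lemma centralGroup_of_dvd_sub_one (hF : ∀ x : K, (x ^ p ^ h) ^ p ^ h = x) (hω : ω ^ p ^ h = -ω)
    (hp3 : 3 < p) {d : ℕ} (hd : d.Prime) (hd3 : 3 < d) (hpd : p ≠ d) {l : Kˣ}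
    (hl : orderOf l = d) (hdvd : d ∣ p - 1) :
    centralGroup (p ^ h) ω l ≤ stabYinf p h ω ∧ Nat.card (centralGroup (p ^ h) ω l) = d * p ∧
      IsInternalSemidirect (centralGroup (p ^ h) ω l) (sigmaCentral (p ^ h) ω)
        (sigmaDiag (p ^ h) ω l) ∧
      ¬ ∀ x ∈ centralGroup (p ^ h) ω l, ∀ y ∈ centralGroup (p ^ h) ω l, x * y = y * x := by
  have hp : p.Prime := Fact.out
  have hx : orderOf (phi (p ^ h) ω 0 1 1) = p := orderOf_phi_translation hp3 (by simp)
  have hy : orderOf (phi (p ^ h) ω 0 0 l) = d := (orderOf_phi_diag l).trans hl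
  obtain ⟨k, hk⟩ := exists_natCast_of_orderOf_dvd (hl ▸ hdvd)
  have hlq : (l : K) ^ (p ^ h + 1) = l ^ 2 := by
    rw [pow_succ, ← hk, ← iterateFrobenius_def, map_natCast, sq]
  have hconj : phi (p ^ h) ω 0 0 l * phi (p ^ h) ω 0 1 1 * (phi (p ^ h) ω 0 0 l)⁻¹ =
      phi (p ^ h) ω 0 (l ^ 2) 1 := by
    rw [phi_diag_conj, hlq, mul_zero, mul_one]
  have hyx : phi (p ^ h) ω 0 0 l * phi (p ^ h) ω 0 1 1 * (phi (p ^ h) ω 0 0 l)⁻¹ =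
      phi (p ^ h) ω 0 1 1 ^ (k ^ 2) := by
    rw [hconj, phi_translation_pow]
    simp [hk]
  obtain ⟨hsd, hcard⟩ := isInternalSemidirect_zpowers hp.ne_zero
    ((Nat.coprime_primes hp hd).mpr hpd) hx hy hyx
  refine ⟨zpowers_sup_le_stabYinf hF hω (by simp) l, hcard, hsd, fun H => ?_⟩
  have e := H _ (hsd.2.1 (Subgroup.mem_zpowers _)) _ (hsd.1 (Subgroup.mem_zpowers _))
  rw [e, mul_inv_cancel_right] at hconj
  have hl2 : l ^ 2 = 1 := Units.ext (by simpa using (phi_injective hconj).2.1.symm)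
  exact absurd (Nat.le_of_dvd two_pos (hl ▸ orderOf_dvd_of_pow_eq_one hl2)) (by omega)

lemma noncentralGroup_of_dvd_sub_one (hF : ∀ x : K, (x ^ p ^ h) ^ p ^ h = x)
    (hω : ω ^ p ^ h = -ω) (hp3 : 3 < p) {d : ℕ} (hd : d.Prime) (hpd : p ≠ d) {l : Kˣ}
    (hl : orderOf l = d) (hdvd : d ∣ p - 1) :
    noncentralGroup (p ^ h) ω l ≤ stabYinf p h ω ∧
      Nat.card (noncentralGroup (p ^ h) ω l) = d * p ∧
      IsInternalSemidirect (noncentralGroup (p ^ h) ω l) (sigmaNoncentral (p ^ h) ω)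
        (sigmaDiag (p ^ h) ω l) ∧
      ¬ ∀ x ∈ noncentralGroup (p ^ h) ω l, ∀ y ∈ noncentralGroup (p ^ h) ω l,
        x * y = y * x := by
  have hp : p.Prime := Fact.out
  have h2 : NeZero (2 : K) := ⟨two_ne_zero_of_three_lt hp3⟩
  have hx : orderOf (phi (p ^ h) ω 1 (ω / 2) 1) = p := orderOf_phi_translation hp3 (by simp)
  have hy : orderOf (phi (p ^ h) ω 0 0 l) = d := (orderOf_phi_diag l).trans hl
  obtain ⟨k, hk⟩ := exists_natCast_of_orderOf_dvd (hl ▸ hdvd)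
  have hlq : (l : K) ^ (p ^ h + 1) = l ^ 2 := by
    rw [pow_succ, ← hk, ← iterateFrobenius_def, map_natCast, sq]
  have hconj : phi (p ^ h) ω 0 0 l * phi (p ^ h) ω 1 (ω / 2) 1 * (phi (p ^ h) ω 0 0 l)⁻¹ =
      phi (p ^ h) ω l (l ^ 2 * (ω / 2)) 1 := by
    rw [phi_diag_conj, hlq, mul_one]
  have hyx : phi (p ^ h) ω 0 0 l * phi (p ^ h) ω 1 (ω / 2) 1 * (phi (p ^ h) ω 0 0 l)⁻¹ =
      phi (p ^ h) ω 1 (ω / 2) 1 ^ k := by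
    -- The choice `b = ω / 2` makes the second coordinate of the `k`-th power exactly `k^2 * ω / 2`.
    rw [hconj, phi_translation_pow, Nat.cast_choose_two, hk, mul_one, one_pow]
    congr 1
    field_simp
    ring
  obtain ⟨hsd, hcard⟩ := isInternalSemidirect_zpowers hp.ne_zero
    ((Nat.coprime_primes hp hd).mpr hpd) hx hy hyx
  refine ⟨zpowers_sup_le_stabYinf hF hω (noncentral_curve hω hp3) l, hcard, hsd, fun H => ?_⟩
  have e := H _ (hsd.2.1 (Subgroup.mem_zpowers _)) _ (hsd.1 (Subgroup.mem_zpowers _))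
  rw [e, mul_inv_cancel_right] at hconj
  have hl1 : l = 1 := Units.ext (by simpa using (phi_injective hconj).1.symm)
  rw [hl1, orderOf_one] at hl
  exact hd.one_lt.ne hl

end Hermitian

open Hermitian in
theorem theorem2 {K : Type*} [Field K] [Finite K] (p d h : ℕ) [Fact p.Prime] [CharP K p]
    (hd : d.Prime) (hp3 : 3 < p) (hd3 : 3 < d) (hpd : p ≠ d)
    (hK : Nat.card K = (p ^ h) ^ 2)
    (ω : K) (hω : ω ^ (p ^ h - 1) = -1) :
    -- up to conjugacy, at most three subgroups of order `d * p`, inside the stabiliser of `Y_∞`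
    (∃ S : Finset (Subgroup PGL(3, K)), S.card ≤ 3 ∧
      (∀ H ∈ S, H ≤ Hermitian.stabYinf p h ω ∧ Nat.card H = d * p) ∧
      ∀ H : Subgroup PGL(3, K), H ≤ Hermitian.PGU p h ω → Nat.card H = d * p →
        ∃ H' ∈ S, ConjugateIn (Hermitian.PGU p h ω) H H') ∧
    -- every subgroup of order `d * p` is conjugate to one on the list
    (∀ H : Subgroup PGL(3, K), H ≤ Hermitian.PGU p h ω → Nat.card H = d * p →
      (∃ l : Kˣ, orderOf l = d) ∧
      ∀ l : Kˣ, orderOf l = d →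
        (d ∣ p ^ h + 1 ∧
          ConjugateIn (Hermitian.PGU p h ω) H (Hermitian.centralGroup (p ^ h) ω l)) ∨
        (d ∣ p - 1 ∧
          ConjugateIn (Hermitian.PGU p h ω) H (Hermitian.centralGroup (p ^ h) ω l)) ∨
        (d ∣ p - 1 ∧
          ConjugateIn (Hermitian.PGU p h ω) H (Hermitian.noncentralGroup (p ^ h) ω l))) ∧
    -- the groups on the list have the stated structure
    (∀ l : Kˣ, orderOf l = d →
      Nat.card (Hermitian.sigmaCentral (p ^ h) ω) = p ∧
      Nat.card (Hermitian.sigmaNoncentral (p ^ h) ω) = p ∧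
      Nat.card (Hermitian.sigmaDiag (p ^ h) ω l) = d ∧
      (d ∣ p ^ h + 1 →
        Hermitian.centralGroup (p ^ h) ω l ≤ Hermitian.stabYinf p h ω ∧
        Nat.card (Hermitian.centralGroup (p ^ h) ω l) = d * p ∧
        IsInternalDirect (Hermitian.centralGroup (p ^ h) ω l)
          (Hermitian.sigmaCentral (p ^ h) ω) (Hermitian.sigmaDiag (p ^ h) ω l) ∧
        IsCyclic (Hermitian.centralGroup (p ^ h) ω l)) ∧
      (d ∣ p - 1 →
        Hermitian.centralGroup (p ^ h) ω l ≤ Hermitian.stabYinf p h ω ∧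
        Nat.card (Hermitian.centralGroup (p ^ h) ω l) = d * p ∧
        IsInternalSemidirect (Hermitian.centralGroup (p ^ h) ω l)
          (Hermitian.sigmaCentral (p ^ h) ω) (Hermitian.sigmaDiag (p ^ h) ω l) ∧
        ¬ ∀ x ∈ Hermitian.centralGroup (p ^ h) ω l,
            ∀ y ∈ Hermitian.centralGroup (p ^ h) ω l, x * y = y * x) ∧
      (d ∣ p - 1 →
        Hermitian.noncentralGroup (p ^ h) ω l ≤ Hermitian.stabYinf p h ω ∧
        Nat.card (Hermitian.noncentralGroup (p ^ h) ω l) = d * p ∧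
        IsInternalSemidirect (Hermitian.noncentralGroup (p ^ h) ω l)
          (Hermitian.sigmaNoncentral (p ^ h) ω) (Hermitian.sigmaDiag (p ^ h) ω l) ∧
        ¬ ∀ x ∈ Hermitian.noncentralGroup (p ^ h) ω l,
            ∀ y ∈ Hermitian.noncentralGroup (p ^ h) ω l, x * y = y * x)) := by
  classical
  have hp : p.Prime := Fact.out
  have hh : h ≠ 0 := by
    rintro rfl
    have := Finite.one_lt_card (α := K)
    rw [hK] at this
    simp at this
  have hF : ∀ x : K, (x ^ p ^ h) ^ p ^ h = x := by
    intro x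
    have := Fintype.ofFinite K
    rw [← pow_mul, ← sq, ← hK, Nat.card_eq_fintype_card, FiniteField.pow_card]
  have hω0 : ω ≠ 0 := by
    rintro rfl
    have h1 := Nat.one_lt_pow hh hp.one_lt
    rw [zero_pow (by omega)] at hω
    simp at hω
  have hωq : ω ^ p ^ h = -ω := pow_eq_neg hω
  have hclass : ∀ H : Subgroup PGL(3, K), H ≤ PGU p h ω → Nat.card H = d * p →
      (∃ l : Kˣ, orderOf l = d) ∧
      ∀ l : Kˣ, orderOf l = d →
        (d ∣ p ^ h + 1 ∧ ConjugateIn (PGU p h ω) H (centralGroup (p ^ h) ω l)) ∨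
        (d ∣ p - 1 ∧ ConjugateIn (PGU p h ω) H (centralGroup (p ^ h) ω l)) ∨
        (d ∣ p - 1 ∧ ConjugateIn (PGU p h ω) H (noncentralGroup (p ^ h) ω l)) := by
    intro H hHle hH
    obtain ⟨a, b, l₀, k, hl₀, hab, hc, hk, hconj⟩ :=
      exists_conj_eq_zpowers_sup hF hωq hω0 hh hp3 hd hpd hHle hH
    refine ⟨⟨l₀, hl₀⟩, fun l hl => ?_⟩
    -- The prescribed `l` is a power of the `l₀` produced by the normal form, so it generates the
    -- same diagonal group.
    obtain ⟨j, rfl⟩ := exists_pow_eq_of_orderOf_eq hd hl₀ hl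
    rw [zpowers_phi_diag_eq hd hl₀ hl] at hconj
    have hk' := pow_mul_conj_eq_pow hk j
    rw [phi_diag_pow] at hk'
    exact (conjugateIn_representative hK hh hF hωq hp3 hd hl hab hc hk').imp
      (And.imp_right hconj.trans)
      (Or.imp (And.imp_right hconj.trans) (And.imp_right hconj.trans))
  refine ⟨?_, hclass, fun l hl => ⟨?_, ?_, ?_,
    centralGroup_of_dvd_succ hF hωq hp3 hd hpd hl,
    centralGroup_of_dvd_sub_one hF hωq hp3 hd hd3 hpd hl,
    noncentralGroup_of_dvd_sub_one hF hωq hp3 hd hpd hl⟩⟩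
  · by_cases hex : ∃ l : Kˣ, orderOf l = d
    · obtain ⟨l, hl⟩ := hex
      -- Cases (I) and (II) give the same subgroup once `l` is fixed, so two candidates suffice; the
      -- filter drops any that lacks the required order or position.
      refine ⟨({centralGroup (p ^ h) ω l, noncentralGroup (p ^ h) ω l} : Finset _).filter
        fun H => H ≤ stabYinf p h ω ∧ Nat.card H = d * p, ?_, ?_, ?_⟩
      · exact (Finset.card_filter_le _ _).trans (Finset.card_le_two.trans (by norm_num))
      · exact fun H hH => (Finset.mem_filter.mp hH).2
      · intro H hHle hH
        rcases (hclass H hHle hH).2 l hl with ⟨hdvd, hconj⟩ | ⟨hdvd, hconj⟩ | ⟨hdvd, hconj⟩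
        · have hs := centralGroup_of_dvd_succ hF hωq hp3 hd hpd hl hdvd
          exact ⟨_, Finset.mem_filter.mpr ⟨by simp, hs.1, hs.2.1⟩, hconj⟩
        · have hs := centralGroup_of_dvd_sub_one hF hωq hp3 hd hd3 hpd hl hdvd
          exact ⟨_, Finset.mem_filter.mpr ⟨by simp, hs.1, hs.2.1⟩, hconj⟩
        · have hs := noncentralGroup_of_dvd_sub_one hF hωq hp3 hd hpd hl hdvd
          exact ⟨_, Finset.mem_filter.mpr ⟨by simp, hs.1, hs.2.1⟩, hconj⟩
    · exact ⟨∅, by simp, by simp, fun H hHle hH => absurd (hclass H hHle hH).1 hex⟩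
  · rw [sigmaCentral, Nat.card_zpowers]
    exact orderOf_phi_translation hp3 (by simp)
  · rw [sigmaNoncentral, Nat.card_zpowers]
    exact orderOf_phi_translation hp3 (by simp)
  · rw [sigmaDiag, Nat.card_zpowers]
    exact (orderOf_phi_diag l).trans hl
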